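/- Let $n\in\{2,3\}$ and let $\Omega\subset\mathbb R^n$ be a bounded domain with piecewise $C^1$ boundary. Let $H^{1/2}(\partial\Omega)$ be the space of traces of functions in $H^1(\Omega)$, with the norm $\|g\|_{H^{1/2}(\partial\Omega)}=\inf\{\|u\|_{H^1(\Omega)}: u\in H^1(\Omega),\ u|_{\partial\Omega}=g\}$, and let $H^{-1/2}(\partial\Omega)$ be its topological dual. Call a pair $(a,c)$ admissible if $a\in C^0(\mathbb R)$, $c\in L^\infty(\Omega)$ and there is a constant $\alpha>0$ with $\alpha\le a(u)\le 1/\alpha$ for all $u\in\mathbb R$ and $0\le c(x)\le 1/\alpha$ for a.e. $x\in\Omega$. For admissible $(a,c)$ and $g\in H^{1/2}(\partial\Omega)$ let $\Lambda_{a,c}\,g\in H^{-1/2}(\partial\Omega)$ be the generalized co-normal derivative $a(u)\partial_n u$, that is, $$\langle \Lambda_{a,c}\,g, w|_{\partial\Omega}\rangle=\int_\Omega a(u)\nabla u\cdot\nabla w+c\,u\,w\,dx\qquad (w\in H^1(\Omega)),$$ where $u\in H^1(\Omega)$ is the weak solution of $-\operatorname{div}(a(u)\nabla u)+cu=0$ in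 $\Omega$, $u=g$ on $\partial\Omega$. Let $\Lambda^*_{a(0),c}\,g\in H^{-1/2}(\partial\Omega)$ be the co-normal derivative $a(0)\partial_n v$, defined by the same formula with the constant $a(0)$ in place of $a(\cdot)$, where $v\in H^1(\Omega)$ is the weak solution of $-a(0)\Delta v+cv=0$ in $\Omega$, $v=g$ on $\partial\Omega$. Then for every admissible $(a,c)$ both boundary value problems have exactly one weak solution for each $g\in H^{1/2}(\partial\Omega)$, the maps $\Lambda_{a,c},\Lambda^*_{a(0),c}:H^{1/2}(\partial\Omega)\to H^{-1/2}(\partial\Omega)$ are well defined, and for every $g^*\in H^{1/2}(\partial\Omega)$ $$\frac1\tau\,\Lambda_{a,c}(\tau g^*)\longrightarrow \Lambda^*_{a(0),c}\,g^*\quad\text{in } H^{-1/2}(\partial\Omega)\text{ as }\tau\to0 .$$ In particular $\Lambda_{a,c}$ determines $\Lambda^*_{a(0),c}$: if $(a_1,c_1)$ and $(a_2,c_2)$ are admissible and $\Lambda_{a_1,c_1}=\Lambda_{a_2,c_2}$, then $\Lambda^*_{a_1(0),c_1}=\Lambda^*_{a_2(0),c_2}$. -/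

import Mathlib

open MeasureTheory Filter Topology
open scoped ContDiff

namespace QuasilinearDtN

/-- The Euclidean space `ℝⁿ`. -/
abbrev E (n : ℕ) : Type := EuclideanSpace ℝ (Fin n)

/-! ### Domains -/

/-- `x` is a regular boundary point of `Ω`: in a neighbourhood `U` of `x`, the set `Ω` is the
sublevel set `{ρ < 0}` of a `C¹` function `ρ` with `ρ x = 0` and `∇ρ(x) ≠ 0`. Thus near `x` the
boundary is a `C¹` hypersurface and `Ω` lies on one side of it. -/
def IsC1BoundaryPoint {n : ℕ} (Ω : Set (E n)) (x : E n) : Prop :=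
  ∃ (U : Set (E n)) (ρ : E n → ℝ), IsOpen U ∧ x ∈ U ∧ ContDiffOn ℝ 1 ρ U ∧
    ρ x = 0 ∧ fderiv ℝ ρ x ≠ 0 ∧ Ω ∩ U = {y ∈ U | ρ y < 0}

/-- The surface measure on `∂Ω`: the `(n-1)`-dimensional Hausdorff measure restricted to `∂Ω`. -/
noncomputable def surface {n : ℕ} (Ω : Set (E n)) : Measure (E n) :=
  (Measure.hausdorffMeasure ((n : ℝ) - 1)).restrict (frontier Ω)

/-- A bounded domain with piecewise `C¹` boundary: a bounded, open, connected, nonempty set whose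
boundary has finite area and is of class `C¹` up to a set of edges and corners of zero area. -/
structure IsPiecewiseC1Domain {n : ℕ} (Ω : Set (E n)) : Prop where
  isOpen : IsOpen Ω
  isConnected : IsConnected Ω
  isBounded : Bornology.IsBounded Ω
  finite_area : surface Ω Set.univ < ⊤
  regular : ∀ᵐ x ∂(surface Ω), IsC1BoundaryPoint Ω x

/-! ### The Sobolev space `H¹(Ω)` -/

/-- `L²(Ω)`. -/
abbrev L2 {n : ℕ} (Ω : Set (E n)) : Type := Lp ℝ 2 (volume.restrict Ω)

/-- `L²(Ω; ℝⁿ)`. -/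
abbrev L2vec {n : ℕ} (Ω : Set (E n)) : Type := Lp (E n) 2 (volume.restrict Ω)

/-- `L²(∂Ω)`. -/
abbrev L2bdry {n : ℕ} (Ω : Set (E n)) : Type := Lp ℝ 2 (surface Ω)

/-- `p` is the weak gradient of `u` in `Ω`:
`∫_Ω u ∂ᵢφ dx = - ∫_Ω pᵢ φ dx` for all `φ ∈ C_c^∞(Ω)` and all `i`. -/
def IsWeakGradient {n : ℕ} {Ω : Set (E n)} (u : L2 Ω) (p : L2vec Ω) : Prop :=
  ∀ φ : E n → ℝ, ContDiff ℝ ∞ φ → HasCompactSupport φ → tsupport φ ⊆ Ω → ∀ i : Fin n,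
    ∫ x in Ω, u x * fderiv ℝ φ x (EuclideanSpace.single i 1) = - ∫ x in Ω, p x i * φ x

lemma integrable_mul_test {n : ℕ} {Ω : Set (E n)} (u : L2 Ω) {f : E n → ℝ}
    (hf : Continuous f) (hc : HasCompactSupport f) :
    Integrable (fun x => u x * f x) (volume.restrict Ω) :=
  MemLp.integrable_mul (p := 2) (q := 2) (Lp.memLp u) (hf.memLp_of_hasCompactSupport hc)

lemma integrable_coord_mul_test {n : ℕ} {Ω : Set (E n)} (p : L2vec Ω) (i : Fin n) {f : E n → ℝ}
    (hf : Continuous f) (hc : HasCompactSupport f) :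
    Integrable (fun x => p x i * f x) (volume.restrict Ω) := by
  have h : MemLp (fun x => p x i) 2 (volume.restrict Ω) :=
    (EuclideanSpace.proj (𝕜 := ℝ) i).comp_memLp' (Lp.memLp p)
  exact MemLp.integrable_mul (p := 2) (q := 2) h (hf.memLp_of_hasCompactSupport hc)

/-- The pairs `(u, ∇u)` with `u ∈ L²(Ω)` and weak gradient `∇u ∈ L²(Ω; ℝⁿ)`. -/
def sobolev {n : ℕ} (Ω : Set (E n)) : Submodule ℝ (WithLp 2 (L2 Ω × L2vec Ω)) where
  carrier := {w | IsWeakGradient w.fst w.snd}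
  zero_mem' := by
    intro φ _ _ _ i
    have h1 : (fun x => ((0 : L2 Ω) x) * fderiv ℝ φ x (EuclideanSpace.single i 1))
        =ᵐ[volume.restrict Ω] 0 := by
      filter_upwards [Lp.coeFn_zero ℝ 2 (volume.restrict Ω)] with x hx
      rw [hx]
      simp
    have h2 : (fun x => ((0 : L2vec Ω) x) i * φ x) =ᵐ[volume.restrict Ω] 0 := by
      filter_upwards [Lp.coeFn_zero (E n) 2 (volume.restrict Ω)] with x hx
      rw [hx]
      simp
    change ∫ x in Ω, ((0 : L2 Ω) x) * fderiv ℝ φ x (EuclideanSpace.single i 1)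
      = - ∫ x in Ω, ((0 : L2vec Ω) x) i * φ x
    rw [integral_congr_ae h1, integral_congr_ae h2]
    simp
  add_mem' := by
    intro w w' hw hw' φ hφ hc hs i
    have hd : Continuous fun x => fderiv ℝ φ x (EuclideanSpace.single i 1) :=
      (hφ.continuous_fderiv (by simp)).clm_apply continuous_const
    have hdc : HasCompactSupport fun x => fderiv ℝ φ x (EuclideanSpace.single i 1) :=
      hc.fderiv_apply (𝕜 := ℝ) _
    have h1 : (fun x => ((w.fst + w'.fst : L2 Ω) x) *
        fderiv ℝ φ x (EuclideanSpace.single i 1)) =ᵐ[volume.restrict Ω]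
        fun x => w.fst x * fderiv ℝ φ x (EuclideanSpace.single i 1) +
          w'.fst x * fderiv ℝ φ x (EuclideanSpace.single i 1) := by
      filter_upwards [Lp.coeFn_add w.fst w'.fst] with x hx
      rw [hx, Pi.add_apply, add_mul]
    have h2 : (fun x => ((w.snd + w'.snd : L2vec Ω) x) i * φ x) =ᵐ[volume.restrict Ω]
        fun x => w.snd x i * φ x + w'.snd x i * φ x := by
      filter_upwards [Lp.coeFn_add w.snd w'.snd] with x hx
      rw [hx, Pi.add_apply, PiLp.add_apply, add_mul]
    change ∫ x in Ω, ((w.fst + w'.fst : L2 Ω) x) * fderiv ℝ φ x (EuclideanSpace.single i 1)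
      = - ∫ x in Ω, ((w.snd + w'.snd : L2vec Ω) x) i * φ x
    rw [integral_congr_ae h1, integral_congr_ae h2,
      integral_add (integrable_mul_test _ hd hdc) (integrable_mul_test _ hd hdc),
      integral_add (integrable_coord_mul_test _ i hφ.continuous hc)
        (integrable_coord_mul_test _ i hφ.continuous hc),
      hw φ hφ hc hs i, hw' φ hφ hc hs i, neg_add]
  smul_mem' := by
    intro r w hw φ hφ hc hs i
    have h1 : (fun x => ((r • w.fst : L2 Ω) x) *
        fderiv ℝ φ x (EuclideanSpace.single i 1)) =ᵐ[volume.restrict Ω]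
        fun x => r * (w.fst x * fderiv ℝ φ x (EuclideanSpace.single i 1)) := by
      filter_upwards [Lp.coeFn_smul r w.fst] with x hx
      rw [hx, Pi.smul_apply, smul_eq_mul, mul_assoc]
    have h2 : (fun x => ((r • w.snd : L2vec Ω) x) i * φ x) =ᵐ[volume.restrict Ω]
        fun x => r * (w.snd x i * φ x) := by
      filter_upwards [Lp.coeFn_smul r w.snd] with x hx
      rw [hx, Pi.smul_apply, PiLp.smul_apply, smul_eq_mul, mul_assoc]
    change ∫ x in Ω, ((r • w.fst : L2 Ω) x) * fderiv ℝ φ x (EuclideanSpace.single i 1)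
      = - ∫ x in Ω, ((r • w.snd : L2vec Ω) x) i * φ x
    rw [integral_congr_ae h1, integral_congr_ae h2, integral_const_mul, integral_const_mul,
      hw φ hφ hc hs i, mul_neg]

/-- `H¹(Ω)`: the pairs `(u, ∇u)` with `u ∈ L²(Ω)` and weak gradient `∇u ∈ L²(Ω; ℝⁿ)` (which is
determined by `u`), with the norm `(‖u‖² + ‖∇u‖²)^{1/2}`. -/
abbrev H1 {n : ℕ} (Ω : Set (E n)) : Type := sobolev Ω

/-- The function `u` underlying an element of `H¹(Ω)`. -/
def H1.fn {n : ℕ} {Ω : Set (E n)} (u : H1 Ω) : L2 Ω := u.1.fst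

/-- The weak gradient `∇u` of an element of `H¹(Ω)`. -/
def H1.grad {n : ℕ} {Ω : Set (E n)} (u : H1 Ω) : L2vec Ω := u.1.snd

/-! ### Traces, `H^{1/2}(∂Ω)` and `H^{-1/2}(∂Ω)` -/

/-- The pairs `(φ|_Ω, φ|_∂Ω)` with `φ ∈ C¹(ℝⁿ)`. -/
noncomputable def classicalTraces {n : ℕ} (Ω : Set (E n)) : Submodule ℝ (H1 Ω × L2bdry Ω) where
  carrier := {q | ∃ φ : E n → ℝ, ContDiff ℝ 1 φ ∧
    (∀ᵐ x ∂(volume.restrict Ω), q.1.fn x = φ x) ∧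
    (∀ᵐ x ∂(volume.restrict Ω), q.1.grad x = gradient φ x) ∧
    (∀ᵐ x ∂(surface Ω), q.2 x = φ x)}
  zero_mem' := by
    refine ⟨fun _ => 0, contDiff_const, ?_, ?_, ?_⟩
    · filter_upwards [Lp.coeFn_zero ℝ 2 (volume.restrict Ω)] with x hx using hx
    · filter_upwards [Lp.coeFn_zero (E n) 2 (volume.restrict Ω)] with x hx
      rw [gradient_fun_const]
      exact hx
    · filter_upwards [Lp.coeFn_zero ℝ 2 (surface Ω)] with x hx using hx
  add_mem' := by
    rintro q q' ⟨φ, hφ, h1, h2, h3⟩ ⟨φ', hφ', h1', h2', h3'⟩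
    refine ⟨fun x => φ x + φ' x, hφ.add hφ', ?_, ?_, ?_⟩
    · filter_upwards [h1, h1', Lp.coeFn_add q.1.fn q'.1.fn] with x e e' hx
      rw [← e, ← e']
      exact hx
    · filter_upwards [h2, h2', Lp.coeFn_add q.1.grad q'.1.grad] with x e e' hx
      have hg : gradient (fun x => φ x + φ' x) x = gradient φ x + gradient φ' x := by
        simp only [gradient]
        rw [fderiv_fun_add (hφ.differentiable (by simp) x) (hφ'.differentiable (by simp) x),
          map_add]
      rw [hg, ← e, ← e']
      exact hx
    · filter_upwards [h3, h3', Lp.coeFn_add q.2 q'.2] with x e e' hx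
      rw [← e, ← e']
      exact hx
  smul_mem' := by
    rintro r q ⟨φ, hφ, h1, h2, h3⟩
    refine ⟨fun x => r * φ x, contDiff_const.mul hφ, ?_, ?_, ?_⟩
    · filter_upwards [h1, Lp.coeFn_smul r q.1.fn] with x e hx
      rw [← e]
      exact hx
    · filter_upwards [h2, Lp.coeFn_smul r q.1.grad] with x e hx
      have hg : gradient (fun x => r * φ x) x = r • gradient φ x := by
        simp only [gradient]
        rw [fderiv_const_mul (hφ.differentiable (by simp) x), map_smul]
      rw [hg, ← e]
      exact hx
    · filter_upwards [h3, Lp.coeFn_smul r q.2] with x e hx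
      rw [← e]
      exact hx

/-- The graph of the trace operator: the closure in `H¹(Ω) × L²(∂Ω)` of the pairs
`(φ|_Ω, φ|_∂Ω)` with `φ ∈ C¹(ℝⁿ)`. -/
noncomputable def traceGraph {n : ℕ} (Ω : Set (E n)) : Submodule ℝ (H1 Ω × L2bdry Ω) :=
  (classicalTraces Ω).topologicalClosure

/-- `g` is the trace of `u ∈ H¹(Ω)` on `∂Ω`: some functions `φₖ ∈ C¹(ℝⁿ)` satisfy `φₖ → u` in
`H¹(Ω)` and `φₖ → g` in `L²(∂Ω)`. -/
def HasTrace {n : ℕ} {Ω : Set (E n)} (u : H1 Ω) (g : L2bdry Ω) : Prop :=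
  (u, g) ∈ traceGraph Ω

/-- The space of traces of functions in `H¹(Ω)`, as a set of functions on `∂Ω`. -/
def traceSpace {n : ℕ} (Ω : Set (E n)) : Submodule ℝ (L2bdry Ω) where
  carrier := {g | ∃ u : H1 Ω, HasTrace u g}
  zero_mem' := ⟨0, (traceGraph Ω).zero_mem⟩
  add_mem' := by
    rintro g g' ⟨u, hu⟩ ⟨u', hu'⟩
    exact ⟨u + u', (traceGraph Ω).add_mem hu hu'⟩
  smul_mem' := by
    rintro r g ⟨u, hu⟩
    exact ⟨r • u, (traceGraph Ω).smul_mem r hu⟩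

/-- `H^{1/2}(∂Ω)`: the space of traces of functions in `H¹(Ω)`. It does not carry the norm of `L²(∂Ω)` but the one
defined below. -/
def HHalf {n : ℕ} (Ω : Set (E n)) : Type := traceSpace Ω

namespace HHalf

variable {n : ℕ} {Ω : Set (E n)}

noncomputable instance : AddCommGroup (HHalf Ω) := inferInstanceAs (AddCommGroup (traceSpace Ω))

noncomputable instance : Module ℝ (HHalf Ω) := inferInstanceAs (Module ℝ (traceSpace Ω))

/-- The inclusion of `H^{1/2}(∂Ω)` into `L²(∂Ω)`. -/
noncomputable def toL2 : HHalf Ω →ₗ[ℝ] L2bdry Ω := (traceSpace Ω).subtype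

lemma exists_extension (g : HHalf Ω) : ∃ u : H1 Ω, HasTrace u g.toL2 := g.2

/-- The norm `‖g‖ = inf {‖u‖_{H¹(Ω)} : u ∈ H¹(Ω), u|_∂Ω = g}` of `H^{1/2}(∂Ω)`. -/
noncomputable instance : Norm (HHalf Ω) where
  norm g := sInf {r : ℝ | ∃ u : H1 Ω, HasTrace u g.toL2 ∧ r = ‖u‖}

lemma norm_def (g : HHalf Ω) :
    ‖g‖ = sInf {r : ℝ | ∃ u : H1 Ω, HasTrace u g.toL2 ∧ r = ‖u‖} := rfl

lemma norm_nonneg' (g : HHalf Ω) : 0 ≤ ‖g‖ :=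
  Real.sInf_nonneg (by rintro r ⟨u, -, rfl⟩; exact norm_nonneg u)

lemma norm_le (g : HHalf Ω) (u : H1 Ω) (hu : HasTrace u g.toL2) : ‖g‖ ≤ ‖u‖ :=
  csInf_le ⟨0, by rintro r ⟨u, -, rfl⟩; exact norm_nonneg u⟩ ⟨u, hu, rfl⟩

lemma exists_lt (g : HHalf Ω) {ε : ℝ} (hε : 0 < ε) :
    ∃ u : H1 Ω, HasTrace u g.toL2 ∧ ‖u‖ < ‖g‖ + ε := by
  obtain ⟨w, hw⟩ := g.exists_extension
  obtain ⟨r, ⟨u, hu, rfl⟩, hlt⟩ :=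
    exists_lt_of_csInf_lt (s := {r : ℝ | ∃ u : H1 Ω, HasTrace u g.toL2 ∧ r = ‖u‖})
      ⟨‖w‖, w, hw, rfl⟩ (lt_add_of_pos_right ‖g‖ hε)
  exact ⟨u, hu, hlt⟩

lemma norm_smul_le' (r : ℝ) (g : HHalf Ω) : ‖r • g‖ ≤ ‖r‖ * ‖g‖ := by
  refine le_of_forall_pos_le_add fun ε hε => ?_
  have hr : 0 < ‖r‖ + 1 := by positivity
  obtain ⟨u, hu, hlt⟩ := g.exists_lt (div_pos hε hr)
  have h1 : ‖r • g‖ ≤ ‖r • u‖ := norm_le _ _ (by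
    rw [map_smul]; exact (traceGraph Ω).smul_mem r hu)
  have h2 : ‖r‖ * ‖u‖ ≤ ‖r‖ * (‖g‖ + ε / (‖r‖ + 1)) :=
    mul_le_mul_of_nonneg_left hlt.le (norm_nonneg r)
  have h3 : ‖r‖ * (ε / (‖r‖ + 1)) ≤ ε := by
    rw [mul_div_assoc', div_le_iff₀ hr]
    nlinarith [norm_nonneg r]
  have h4 : ‖r • u‖ = ‖r‖ * ‖u‖ := norm_smul r u
  linarith

noncomputable instance : SeminormedAddCommGroup (HHalf Ω) :=
  AddGroupSeminorm.toSeminormedAddCommGroup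
    { toFun := fun g => ‖g‖
      map_zero' := le_antisymm
        ((norm_le 0 0 (by rw [map_zero]; exact (traceGraph Ω).zero_mem)).trans norm_zero.le)
        (norm_nonneg' 0)
      add_le' := by
        intro g g'
        refine le_of_forall_pos_le_add fun ε hε => ?_
        obtain ⟨u, hu, hlt⟩ := g.exists_lt (half_pos hε)
        obtain ⟨u', hu', hlt'⟩ := g'.exists_lt (half_pos hε)
        have h1 : ‖g + g'‖ ≤ ‖u + u'‖ := norm_le _ _ (by
          rw [map_add]; exact (traceGraph Ω).add_mem hu hu')
        linarith [norm_add_le u u']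
      neg' := by
        have key : ∀ g : HHalf Ω, ‖-g‖ ≤ ‖g‖ := fun g => by
          have h := norm_smul_le' (-1) g
          rwa [neg_one_smul, norm_neg, norm_one, one_mul] at h
        intro g
        refine le_antisymm (key g) ?_
        have h := key (-g)
        rwa [neg_neg] at h }

noncomputable instance : NormedSpace ℝ (HHalf Ω) where
  norm_smul_le := norm_smul_le'

end HHalf

/-- `H^{-1/2}(∂Ω)`: the topological dual of `H^{1/2}(∂Ω)`, with the dual norm. -/
abbrev HMinusHalf {n : ℕ} (Ω : Set (E n)) : Type := HHalf Ω →L[ℝ] ℝ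

/-! ### The boundary value problems and the Dirichlet-to-Neumann maps -/

/-- Admissible coefficients: `a ∈ C⁰(ℝ)`, `c ∈ L^∞(Ω)`, and for some `α > 0` one has
`α ≤ a ≤ 1/α` on `ℝ` and `0 ≤ c ≤ 1/α` a.e. in `Ω`. -/
def Admissible {n : ℕ} (Ω : Set (E n)) (a : ℝ → ℝ) (c : E n → ℝ) : Prop :=
  Continuous a ∧ AEStronglyMeasurable c (volume.restrict Ω) ∧
    ∃ α : ℝ, 0 < α ∧ (∀ t, α ≤ a t ∧ a t ≤ 1 / α) ∧
      ∀ᵐ x ∂(volume.restrict Ω), 0 ≤ c x ∧ c x ≤ 1 / α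

/-- `∫_Ω a(u) ∇u · ∇v + c u v dx`. -/
noncomputable def form {n : ℕ} {Ω : Set (E n)} (a : ℝ → ℝ) (c : E n → ℝ) (u v : H1 Ω) : ℝ :=
  ∫ x in Ω, (a (u.fn x) * inner ℝ (u.grad x) (v.grad x) + c x * u.fn x * v.fn x)

/-- `u ∈ H¹(Ω)` is a weak solution of `-div(a(u)∇u) + c u = 0` in `Ω`, `u = g` on `∂Ω`; the
test functions are the `v ∈ H¹(Ω)` with vanishing trace. -/
def IsWeakSolution {n : ℕ} {Ω : Set (E n)} (a : ℝ → ℝ) (c : E n → ℝ) (g : HHalf Ω)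
    (u : H1 Ω) : Prop :=
  HasTrace u g.toL2 ∧ ∀ v : H1 Ω, HasTrace v 0 → form a c u v = 0

/-- `ψ ∈ H^{-1/2}(∂Ω)` is the generalized co-normal derivative `a(u)∂ₙu`:
`⟨ψ, v|_∂Ω⟩ = ∫_Ω a(u) ∇u · ∇v + c u v dx` for all `v ∈ H¹(Ω)`. -/
def IsConormalDerivative {n : ℕ} {Ω : Set (E n)} (a : ℝ → ℝ) (c : E n → ℝ) (u : H1 Ω)
    (ψ : HMinusHalf Ω) : Prop :=
  ∀ (v : H1 Ω) (h : HHalf Ω), HasTrace v h.toL2 → ψ h = form a c u v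

/-- The Dirichlet-to-Neumann map `Λ_{a,c} : H^{1/2}(∂Ω) → H^{-1/2}(∂Ω)`, `g ↦ a(u)∂ₙu`, where
`u` is the weak solution of `-div(a(u)∇u) + c u = 0` in `Ω`, `u = g` on `∂Ω`. -/
noncomputable def DtN {n : ℕ} (Ω : Set (E n)) (a : ℝ → ℝ) (c : E n → ℝ) (g : HHalf Ω) :
    HMinusHalf Ω :=
  Classical.epsilon fun ψ => ∃ u : H1 Ω, IsWeakSolution a c g u ∧ IsConormalDerivative a c u ψ

/-- The Dirichlet-to-Neumann map `Λ*_{k,c} : g ↦ k ∂ₙv` of the linear problem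
`-k Δv + c v = 0` in `Ω`, `v = g` on `∂Ω`, with a constant `k` (the problem above with the
constant function `k` in place of `a`). -/
noncomputable def linearDtN {n : ℕ} (Ω : Set (E n)) (k : ℝ) (c : E n → ℝ) (g : HHalf Ω) :
    HMinusHalf Ω :=
  DtN Ω (fun _ => k) c g

end QuasilinearDtN

namespace QuasilinearDtN

section

/-! ### The Friedrichs inequality -/

/-! With `A(t) = ∫₀ᵗ a` and `B = A⁻¹`, the Kirchhoff transform `U = A(u)` satisfies `∇U = a(u)∇u`
and turns the quasilinear problem into `-ΔU + c B(U) = 0`, `U = A(g)` on the boundary. Its only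
nonlinearity is the increasing Lipschitz function `B`, and `c ≥ 0`, so the problem is strongly
monotone on functions of zero trace once a Poincaré inequality is known
(`exists_transformed_solution`, `IsWeakSolution.unique`). The transform acts on weak solutions and
traces by `chain`.

For the limit, let `u` solve the quasilinear problem with data `τg` and `z` the linear one with data
`g`. The functions `A(u)` and `A(τz)` have the same trace, so `D = (A(u) - A(τz))/τ` is a valid test
function. The difference of the scaled fluxes is `∇D + r` with `r = (a(τz) - a(0))∇z`, and `u/τ - z`
has the sign of `D` because `A` increases. Testing with `D` gives `‖∇D‖ ≤ ‖r‖`, and `r → 0` in `L²`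
by dominated convergence. This bounds the co-normal derivatives uniformly over normalized test
functions (`exists_quotient`), and the determination statement is uniqueness of limits.

The trace is a closed linear relation, the closure of the pairs coming from `C¹(ℝⁿ)`. The Poincaré
inequality therefore follows from `friedrichs`, an estimate with a boundary term that is proved for
`C¹` functions along lines parallel to the first axis and passes to the closure. -/

lemma sq_le_of_hasDerivAt {f f' : ℝ → ℝ} (hf : ∀ t, HasDerivAt f (f' t) t) (hf' : Continuous f')
    {s t : ℝ} (hst : s < t) :
    f t ^ 2 ≤ 2 * f s ^ 2 + 2 * (t - s) * ∫ r in s..t, f' r ^ 2 := by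
  set I := ∫ r in s..t, f' r with hI
  have h1 : I = f t - f s := intervalIntegral.integral_eq_sub_of_hasDerivAt (fun x _ => hf x)
    (hf'.intervalIntegrable _ _)
  have hpos : 0 < t - s := sub_pos.2 hst
  -- The variance of `f'` about its mean `I / (t - s)` is nonnegative; expanded, this is the
  -- Cauchy–Schwarz bound `h4`.
  have h2 : 0 ≤ ∫ r in s..t, (f' r - I / (t - s)) ^ 2 :=
    intervalIntegral.integral_nonneg hst.le (fun _ _ => sq_nonneg _)
  have h3 : ∫ r in s..t, (f' r - I / (t - s)) ^ 2
      = (∫ r in s..t, f' r ^ 2) - I ^ 2 / (t - s) := by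
    have e : ∀ r, (f' r - I / (t - s)) ^ 2
        = f' r ^ 2 - 2 * (I / (t - s)) * f' r + (I / (t - s)) ^ 2 := fun r => by ring
    simp_rw [e]
    rw [intervalIntegral.integral_add, intervalIntegral.integral_sub,
      intervalIntegral.integral_const_mul, ← hI, intervalIntegral.integral_const, smul_eq_mul]
    · field_simp
      ring
    all_goals exact Continuous.intervalIntegrable (by fun_prop) _ _
  have h4 : I ^ 2 ≤ (t - s) * ∫ r in s..t, f' r ^ 2 := by
    rw [h3, sub_nonneg, div_le_iff₀ hpos] at h2
    linarith
  have h5 : f t = f s + I := by linarith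
  rw [h5]
  linarith [sq_nonneg (f s - I)]

/-- The point is the last element of the complement before `t`. That all of `(s, t]` lies in `O`
lets the integral of the derivative from `s` to `t` be bounded by its integral over `O`. -/
lemma exists_left_frontier {O : Set ℝ} (hO : IsOpen O) {R : ℝ} (hR : O ⊆ Set.Icc (-R) R) {t : ℝ}
    (ht : t ∈ O) : ∃ s ∈ frontier O, s < t ∧ -R ≤ s ∧ Set.Ioc s t ⊆ O := by
  set S := Oᶜ ∩ Set.Iic t with hS
  have hne : S.Nonempty := by
    refine ⟨-R - 1, fun h => ?_, ?_⟩
    · linarith [(hR h).1]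
    · have := (hR ht).1
      simp only [Set.mem_Iic]
      linarith
  have hbd : BddAbove S := ⟨t, fun x hx => hx.2⟩
  have hmem : sSup S ∈ S := (hO.isClosed_compl.inter isClosed_Iic).csSup_mem hne hbd
  have hlt : sSup S < t := lt_of_le_of_ne hmem.2 (fun h => hmem.1 (h ▸ ht))
  have hsub : Set.Ioc (sSup S) t ⊆ O := fun x hx => by
    by_contra h
    exact absurd (le_csSup hbd ⟨h, hx.2⟩) (not_le.2 hx.1)
  have hcl : sSup S ∈ closure O := by
    have : sSup S ∈ closure (Set.Ioc (sSup S) t) := by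
      rw [closure_Ioc hlt.ne]
      exact ⟨le_rfl, hlt.le⟩
    exact closure_mono hsub this
  refine ⟨sSup S, ?_, hlt, ?_, hsub⟩
  · rw [hO.frontier_eq]
    exact ⟨hcl, hmem.1⟩
  · have := closure_minimal hR isClosed_Icc hcl
    exact this.1

lemma lintegral_sq_le_of_hasDerivAt {f f' : ℝ → ℝ} (hf : ∀ t, HasDerivAt f (f' t) t)
    (hf' : Continuous f') {O : Set ℝ} (hO : IsOpen O) {R : ℝ} (hR : O ⊆ Set.Icc (-R) R) (hR0 : 0 ≤ R)
    {M : ℝ} (hM : ∀ s ∈ frontier O, f s ^ 2 ≤ M) (hM0 : 0 ≤ M) :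
    ∫⁻ t in O, ENNReal.ofReal (f t ^ 2) ≤ ENNReal.ofReal (4 * R) * ENNReal.ofReal M +
      ENNReal.ofReal (8 * R ^ 2) * ∫⁻ t in O, ENNReal.ofReal (f' t ^ 2) := by
  set J := ∫⁻ t in O, ENNReal.ofReal (f' t ^ 2) with hJ
  have key : ∀ t ∈ O, ENNReal.ofReal (f t ^ 2) ≤
      ENNReal.ofReal (2 * M) + ENNReal.ofReal (4 * R) * J := by
    intro t ht
    obtain ⟨s, hs, hst, hRs, hsub⟩ := exists_left_frontier hO hR ht
    have hI0 : 0 ≤ ∫ r in s..t, f' r ^ 2 :=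
      intervalIntegral.integral_nonneg hst.le (fun _ _ => sq_nonneg _)
    have h1 : f t ^ 2 ≤ 2 * M + 4 * R * ∫ r in s..t, f' r ^ 2 := by
      have h2 := sq_le_of_hasDerivAt hf hf' hst
      have h3 := hM s hs
      have h4 : t - s ≤ 2 * R := by linarith [(hR ht).2]
      nlinarith [mul_le_mul_of_nonneg_right h4 hI0]
    have h5 : ENNReal.ofReal (∫ r in s..t, f' r ^ 2) ≤ J := by
      rw [intervalIntegral.integral_of_le hst.le, ofReal_integral_eq_lintegral_ofReal]
      · exact lintegral_mono_set hsub
      · exact (Continuous.integrableOn_Icc (by fun_prop)).mono_set Set.Ioc_subset_Icc_self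
      · exact ae_of_all _ fun _ => sq_nonneg _
    calc ENNReal.ofReal (f t ^ 2) ≤ _ := ENNReal.ofReal_le_ofReal h1
      _ = ENNReal.ofReal (2 * M) + ENNReal.ofReal (4 * R) *
          ENNReal.ofReal (∫ r in s..t, f' r ^ 2) := by
        rw [ENNReal.ofReal_add (by positivity) (by positivity),
          ENNReal.ofReal_mul (p := 4 * R) (by positivity)]
      _ ≤ _ := by gcongr
  have hvol : volume O ≤ ENNReal.ofReal (2 * R) := by
    refine (measure_mono hR).trans ?_
    rw [Real.volume_Icc]
    exact ENNReal.ofReal_le_ofReal (by linarith)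
  -- The pointwise bound `2M + 4R J` does not depend on `t`; multiplying it by the length `2R` gives
  -- the constants `4R` and `8R²`.
  calc ∫⁻ t in O, ENNReal.ofReal (f t ^ 2)
      ≤ ∫⁻ t in O, (ENNReal.ofReal (2 * M) + ENNReal.ofReal (4 * R) * J) :=
        setLIntegral_mono' hO.measurableSet key
    _ = (ENNReal.ofReal (2 * M) + ENNReal.ofReal (4 * R) * J) * volume O := by
        rw [lintegral_const, Measure.restrict_apply_univ]
    _ ≤ (ENNReal.ofReal (2 * M) + ENNReal.ofReal (4 * R) * J) * ENNReal.ofReal (2 * R) := by gcongr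
    _ = _ := by
      rw [add_mul, mul_right_comm _ J, ← ENNReal.ofReal_mul (by positivity),
        ← ENNReal.ofReal_mul (by positivity), ← ENNReal.ofReal_mul (by positivity)]
      ring_nf

/-! ### Slicing along the first coordinate -/

/-- The projection forgetting the first coordinate. -/
def dropFirst {m : ℕ} (x : E (m + 1)) : Fin m → ℝ := fun i => x i.succ

/-- The point with first coordinate `t` and remaining coordinates `y`. -/
def consPoint {m : ℕ} (t : ℝ) (y : Fin m → ℝ) : E (m + 1) := WithLp.toLp 2 (Fin.cons t y)

lemma lipschitzWith_dropFirst {m : ℕ} : LipschitzWith 1 (dropFirst (m := m)) := by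
  refine LipschitzWith.of_dist_le_mul fun x y => ?_
  rw [NNReal.coe_one, one_mul, dist_pi_le_iff dist_nonneg]
  intro i
  rw [Real.dist_eq, dist_eq_norm]
  exact PiLp.norm_apply_le (x - y) i.succ

/-- The largest value of `F` on the part of `S` above `y`. -/
noncomputable def fibreSup {m : ℕ} (S : Set (E (m + 1))) (F : E (m + 1) → ℝ) (y : Fin m → ℝ) : ℝ :=
  sSup (F '' (S ∩ dropFirst ⁻¹' {y}))

lemma bddAbove_fibre {m : ℕ} {S : Set (E (m + 1))} (hS : IsCompact S) {F : E (m + 1) → ℝ}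
    (hF : Continuous F) (y : Fin m → ℝ) : BddAbove (F '' (S ∩ dropFirst ⁻¹' {y})) :=
  (hS.image hF).bddAbove.mono (Set.image_mono Set.inter_subset_left)

/-- By the layer-cake formula it suffices to compare superlevel sets: that of the fibre supremum is
contained in the projection of `{F > t} ∩ S`, and a 1-Lipschitz projection does not increase
Hausdorff measure. On `Fin m → ℝ` with the sup norm, `m`-dimensional Hausdorff measure is Lebesgue
measure. -/
lemma lintegral_fibreSup_le {m : ℕ} {S : Set (E (m + 1))} {F : E (m + 1) → ℝ}
    (hF : Continuous F) (hF0 : ∀ x, 0 ≤ F x) :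
    ∫⁻ y, ENNReal.ofReal (fibreSup S F y) ≤
      ∫⁻ x in S, ENNReal.ofReal (F x) ∂(Measure.hausdorffMeasure (m : ℝ)) := by
  -- Measurability of the fibre supremum is not established, so a measurable minorant with the same
  -- lower integral replaces it.
  obtain ⟨g, hg, hgle, heq⟩ := exists_measurable_le_lintegral_eq (volume : Measure (Fin m → ℝ))
    (fun y => ENNReal.ofReal (fibreSup S F y))
  have hg' : ∀ y, g y = ENNReal.ofReal (g y).toReal := fun y =>
    (ENNReal.ofReal_toReal (ne_top_of_le_ne_top ENNReal.ofReal_ne_top (hgle y))).symm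
  rw [heq, lintegral_congr hg', lintegral_eq_lintegral_meas_lt _
    (ae_of_all _ fun _ => ENNReal.toReal_nonneg) hg.ennreal_toReal.aemeasurable,
    lintegral_eq_lintegral_meas_lt _ (ae_of_all _ hF0) hF.aemeasurable]
  refine setLIntegral_mono' measurableSet_Ioi fun t (ht : 0 < t) => ?_
  have hsub : {y | t < (g y).toReal} ⊆ dropFirst '' ({x | t < F x} ∩ S) := by
    intro y (hy : t < (g y).toReal)
    have h1 : t < fibreSup S F y := by
      by_contra! h
      have h2 := (hgle y).trans (ENNReal.ofReal_le_ofReal h)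
      have h3 := ENNReal.toReal_mono ENNReal.ofReal_ne_top h2
      rw [ENNReal.toReal_ofReal ht.le] at h3
      exact absurd hy (not_lt.2 h3)
    -- Over an empty fibre the supremum takes the default value `0`, which is not above `t > 0`.
    have hne : (F '' (S ∩ dropFirst ⁻¹' {y})).Nonempty := by
      by_contra h
      rw [Set.not_nonempty_iff_eq_empty] at h
      rw [fibreSup, h, Real.sSup_empty] at h1
      exact lt_asymm h1 ht
    obtain ⟨_, ⟨x, ⟨hxS, hxy⟩, rfl⟩, hlt⟩ := exists_lt_of_lt_csSup hne h1
    exact ⟨x, ⟨hlt, hxS⟩, hxy⟩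
  calc volume {y | t < (g y).toReal} ≤ volume (dropFirst '' ({x | t < F x} ∩ S)) := measure_mono hsub
    _ = Measure.hausdorffMeasure (m : ℝ) (dropFirst '' ({x | t < F x} ∩ S)) := by
      rw [← hausdorffMeasure_pi_real, Fintype.card_fin]
    _ ≤ Measure.hausdorffMeasure (m : ℝ) ({x | t < F x} ∩ S) := by
      simpa using lipschitzWith_dropFirst.hausdorffMeasure_image_le (Nat.cast_nonneg m)
        ({x | t < F x} ∩ S)
    _ = _ := by rw [Measure.restrict_apply (measurableSet_lt measurable_const hF.measurable)]

lemma measurable_consPoint {m : ℕ} :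
    Measurable (fun p : ℝ × (Fin m → ℝ) => consPoint p.1 p.2) := by
  have : Continuous (fun p : ℝ × (Fin m → ℝ) => consPoint p.1 p.2) := by
    refine (PiLp.continuous_toLp 2 _).comp (continuous_pi fun i => ?_)
    refine Fin.cases ?_ (fun j => ?_) i
    · simpa using continuous_fst
    · simpa using (show Continuous fun a : ℝ × (Fin m → ℝ) => a.2 j by fun_prop)
  exact this.measurable

lemma measurePreserving_consPoint {m : ℕ} :
    MeasurePreserving (fun p : ℝ × (Fin m → ℝ) => consPoint p.1 p.2) := by
  have h := (PiLp.volume_preserving_toLp (Fin (m + 1))).comp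
    (volume_preserving_piFinSuccAbove (fun _ : Fin (m + 1) => ℝ) 0).symm
  convert h using 1
  funext p
  change _ = WithLp.toLp 2 ((MeasurableEquiv.piFinSuccAbove (fun _ => ℝ) 0).symm p)
  rw [consPoint]
  congr 1
  ext i
  refine Fin.cases ?_ (fun j => ?_) i <;> simp [MeasurableEquiv.piFinSuccAbove]

lemma lintegral_eq_lintegral_consPoint {m : ℕ} {f : E (m + 1) → ENNReal} (hf : Measurable f) :
    ∫⁻ x, f x = ∫⁻ y : Fin m → ℝ, ∫⁻ t : ℝ, f (consPoint t y) := by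
  rw [← measurePreserving_consPoint.lintegral_comp hf]
  exact lintegral_prod_symm _ (hf.comp measurable_consPoint).aemeasurable

lemma setLIntegral_eq_lintegral_consPoint {m : ℕ} {f : E (m + 1) → ENNReal} (hf : Measurable f)
    {Ω : Set (E (m + 1))} (hΩ : MeasurableSet Ω) :
    ∫⁻ x in Ω, f x = ∫⁻ y : Fin m → ℝ, ∫⁻ t in {t | consPoint t y ∈ Ω}, f (consPoint t y) := by
  rw [← lintegral_indicator hΩ, lintegral_eq_lintegral_consPoint (hf.indicator hΩ)]
  refine lintegral_congr fun y => ?_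
  rw [← lintegral_indicator]
  · rfl
  · exact (measurable_consPoint.comp (measurable_id.prodMk measurable_const)) hΩ

lemma consPoint_eq {m : ℕ} (t : ℝ) (y : Fin m → ℝ) :
    consPoint t y = consPoint 0 y + t • EuclideanSpace.single 0 (1 : ℝ) := by
  ext i
  refine Fin.cases ?_ (fun j => ?_) i <;> simp [consPoint]

lemma hasDerivAt_consPoint {m : ℕ} {φ : E (m + 1) → ℝ} (hφ : ContDiff ℝ 1 φ) (y : Fin m → ℝ)
    (t : ℝ) : HasDerivAt (fun t => φ (consPoint t y))
      (fderiv ℝ φ (consPoint t y) (EuclideanSpace.single 0 1)) t := by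
  have h : HasDerivAt (fun t => consPoint t y) (EuclideanSpace.single 0 (1 : ℝ)) t := by
    have h1 : (fun t => consPoint t y)
        = fun t => consPoint 0 y + t • EuclideanSpace.single 0 (1 : ℝ) :=
      funext fun t => consPoint_eq t y
    rw [h1]
    simpa using ((hasDerivAt_id t).smul_const (EuclideanSpace.single 0 (1 : ℝ))).const_add
      (consPoint 0 y)
  exact ((hφ.differentiable (by simp) _).hasFDerivAt).comp_hasDerivAt t h

lemma continuous_consPoint {m : ℕ} (y : Fin m → ℝ) : Continuous (fun t => consPoint t y) := by
  have h1 : (fun t => consPoint t y)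
      = fun t => consPoint 0 y + t • EuclideanSpace.single 0 (1 : ℝ) :=
    funext fun t => consPoint_eq t y
  rw [h1]
  fun_prop

/-- On each line the one-dimensional estimate applies with `M` the supremum of `φ²` over the
boundary points of that line; integrating over the lines, `lintegral_fibreSup_le` bounds these
suprema by the surface integral. -/
lemma friedrichs_of_contDiff {m : ℕ} {Ω : Set (E (m + 1))} (hΩ : IsOpen Ω) {R : ℝ} (hR0 : 0 ≤ R)
    (hR : Ω ⊆ Metric.closedBall 0 R) {φ : E (m + 1) → ℝ} (hφ : ContDiff ℝ 1 φ) :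
    ∫⁻ x in Ω, ENNReal.ofReal (φ x ^ 2) ≤
      ENNReal.ofReal (4 * R) * ∫⁻ x, ENNReal.ofReal (φ x ^ 2) ∂(surface Ω) +
      ENNReal.ofReal (8 * R ^ 2) *
        ∫⁻ x in Ω, ENNReal.ofReal (fderiv ℝ φ x (EuclideanSpace.single 0 1) ^ 2) := by
  have hdc : Continuous fun x => fderiv ℝ φ x (EuclideanSpace.single 0 1) :=
    (hφ.continuous_fderiv (by simp)).clm_apply continuous_const
  have hcomp : IsCompact (frontier Ω) :=
    ((isCompact_closedBall (0 : E (m + 1)) R).of_isClosed_subset isClosed_closure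
      (closure_minimal hR Metric.isClosed_closedBall)).of_isClosed_subset isClosed_frontier
      frontier_subset_closure
  have hsq : Continuous fun x => φ x ^ 2 := hφ.continuous.pow 2
  have hm1 : Measurable fun x => ENNReal.ofReal (φ x ^ 2) := hsq.measurable.ennreal_ofReal
  have hm2 : Measurable fun x =>
      ENNReal.ofReal (fderiv ℝ φ x (EuclideanSpace.single 0 1) ^ 2) :=
    (hdc.pow 2).measurable.ennreal_ofReal
  have hsurf : ∫⁻ y, ENNReal.ofReal (fibreSup (frontier Ω) (fun x => φ x ^ 2) y) ≤
      ∫⁻ x, ENNReal.ofReal (φ x ^ 2) ∂(surface Ω) := by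
    have h := lintegral_fibreSup_le (S := frontier Ω) hsq (fun x => sq_nonneg _)
    have e : (((m + 1 : ℕ) : ℝ) - 1) = m := by push_cast; ring
    rw [surface, e]
    exact h
  rw [setLIntegral_eq_lintegral_consPoint hm1 hΩ.measurableSet,
    setLIntegral_eq_lintegral_consPoint hm2 hΩ.measurableSet]
  have hslice : ∀ y : Fin m → ℝ,
      ∫⁻ t in {t | consPoint t y ∈ Ω}, ENNReal.ofReal (φ (consPoint t y) ^ 2) ≤
      ENNReal.ofReal (4 * R) *
        ENNReal.ofReal (fibreSup (frontier Ω) (fun x => φ x ^ 2) y) +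
      ENNReal.ofReal (8 * R ^ 2) * ∫⁻ t in {t | consPoint t y ∈ Ω},
        ENNReal.ofReal (fderiv ℝ φ (consPoint t y) (EuclideanSpace.single 0 1) ^ 2) := by
    intro y
    have hc := continuous_consPoint y
    refine lintegral_sq_le_of_hasDerivAt (fun t => hasDerivAt_consPoint hφ y t) (hdc.comp hc)
      (hΩ.preimage hc) ?_ hR0 ?_ ?_
    · intro t ht
      have h1 : ‖consPoint t y‖ ≤ R := by simpa using hR ht
      have h2 : |t| ≤ R := (PiLp.norm_apply_le (consPoint t y) 0).trans h1
      exact abs_le.1 h2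
    · intro s hs
      have hs' : consPoint s y ∈ frontier Ω := hc.frontier_preimage_subset Ω hs
      exact le_csSup (bddAbove_fibre hcomp hsq y) ⟨_, ⟨hs', rfl⟩, rfl⟩
    · refine Real.sSup_nonneg ?_
      rintro _ ⟨x, -, rfl⟩
      exact sq_nonneg _
  have hm3 : Measurable fun y : Fin m → ℝ => ∫⁻ t in {t | consPoint t y ∈ Ω},
        ENNReal.ofReal (fderiv ℝ φ (consPoint t y) (EuclideanSpace.single 0 1) ^ 2) := by
    have h : Measurable fun y : Fin m → ℝ => ∫⁻ t : ℝ, Ω.indicator (fun x =>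
        ENNReal.ofReal (fderiv ℝ φ x (EuclideanSpace.single 0 1) ^ 2)) (consPoint t y) :=
      Measurable.lintegral_prod_left
        ((hm2.indicator hΩ.measurableSet).comp (measurable_consPoint (m := m)))
    convert h using 2 with y
    exact (lintegral_indicator (hΩ.measurableSet.preimage (continuous_consPoint y).measurable) _).symm
  refine (lintegral_mono hslice).trans ?_
  -- Additivity is used in the form needing only the second summand to be measurable (`hm3`), since
  -- nothing is known for the fibre supremum.
  rw [lintegral_add_right _ (hm3.const_mul _), lintegral_const_mul' _ _ ENNReal.ofReal_ne_top,
    lintegral_const_mul' _ _ ENNReal.ofReal_ne_top]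
  gcongr

end

section

/-! ### Dominated convergence and bounded multipliers in `L²` -/

section L2

variable {X F : Type*} [MeasurableSpace X] {μ : Measure X} [NormedAddCommGroup F]

lemma integrable_norm_sq (f : Lp F 2 μ) : Integrable (fun x => ‖f x‖ ^ 2) μ :=
  (memLp_two_iff_integrable_sq_norm (Lp.aestronglyMeasurable f)).1 (Lp.memLp f)

variable [InnerProductSpace ℝ F]

lemma norm_sq_eq_integral (f : Lp F 2 μ) : ‖f‖ ^ 2 = ∫ x, ‖f x‖ ^ 2 ∂μ := by
  rw [← real_inner_self_eq_norm_sq, L2.inner_def]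
  simp_rw [real_inner_self_eq_norm_sq]

lemma ofReal_norm_sq_eq_lintegral (f : Lp F 2 μ) :
    ENNReal.ofReal (‖f‖ ^ 2) = ∫⁻ x, ENNReal.ofReal (‖f x‖ ^ 2) ∂μ := by
  rw [norm_sq_eq_integral, ofReal_integral_eq_lintegral_ofReal (integrable_norm_sq f)
    (ae_of_all _ fun _ => sq_nonneg _)]

/-- Dominated convergence in `L²`. -/
lemma tendsto_L2_of_dominated {ι : Type*} {l : Filter ι} [l.IsCountablyGenerated]
    {f : ι → Lp F 2 μ} {g : Lp F 2 μ} {b : X → ℝ} (hb : Integrable (fun x => b x ^ 2) μ)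
    (hbd : ∀ᶠ i in l, ∀ᵐ x ∂μ, ‖f i x - g x‖ ≤ b x)
    {φ : ι → X → F} (hφ : ∀ i, f i =ᵐ[μ] φ i)
    (hlim : ∀ᵐ x ∂μ, Tendsto (fun i => φ i x) l (𝓝 (g x))) : Tendsto f l (𝓝 g) := by
  have hφm : ∀ i, AEStronglyMeasurable (φ i) μ := fun i =>
    (Lp.aestronglyMeasurable (f i)).congr (hφ i)
  have h1 : ∀ i, ‖f i - g‖ ^ 2 = ∫ x, ‖φ i x - g x‖ ^ 2 ∂μ := by
    intro i
    rw [norm_sq_eq_integral]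
    refine integral_congr_ae ?_
    filter_upwards [Lp.coeFn_sub (f i) g, hφ i] with x hx hx'
    rw [hx, Pi.sub_apply, hx']
  have h2 : Tendsto (fun i => ∫ x, ‖φ i x - g x‖ ^ 2 ∂μ) l (𝓝 (∫ _, (0 : ℝ) ∂μ)) := by
    refine tendsto_integral_filter_of_dominated_convergence (fun x => b x ^ 2) ?_ ?_ hb ?_
    · exact Eventually.of_forall fun i =>
        ((hφm i).sub (Lp.aestronglyMeasurable g)).norm.pow 2
    · filter_upwards [hbd] with i hi
      filter_upwards [hi, hφ i] with x hx hx'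
      rw [hx'] at hx
      rw [norm_pow, norm_norm]
      exact pow_le_pow_left₀ (norm_nonneg _) hx 2
    · filter_upwards [hlim] with x hx
      have := ((hx.sub_const (g x)).norm).pow 2
      simpa using this
  rw [tendsto_iff_norm_sub_tendsto_zero]
  have h3 : Tendsto (fun i => Real.sqrt (‖f i - g‖ ^ 2)) l (𝓝 (Real.sqrt 0)) := by
    refine (Real.continuous_sqrt.tendsto 0).comp ?_
    simpa [h1] using h2
  simpa [Real.sqrt_sq (norm_nonneg _)] using h3

variable {b : X → ℝ} {K : ℝ}

lemma memLp_smul (hb : AEStronglyMeasurable b μ) (hK : ∀ᵐ x ∂μ, |b x| ≤ K) (p : Lp F 2 μ) :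
    MemLp (fun x => b x • p x) 2 μ := by
  refine (Lp.memLp p).of_le_mul (hb.smul (Lp.aestronglyMeasurable p)) (c := K) ?_
  filter_upwards [hK] with x hx
  rw [norm_smul]
  exact mul_le_mul_of_nonneg_right hx (norm_nonneg _)

/-- The product of a bounded function and an `L²` function. -/
noncomputable def bddSMul (hb : AEStronglyMeasurable b μ) (hK : ∀ᵐ x ∂μ, |b x| ≤ K)
    (p : Lp F 2 μ) : Lp F 2 μ := (memLp_smul hb hK p).toLp _

lemma coeFn_bddSMul (hb : AEStronglyMeasurable b μ) (hK : ∀ᵐ x ∂μ, |b x| ≤ K)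
    (p : Lp F 2 μ) : bddSMul hb hK p =ᵐ[μ] fun x => b x • p x := MemLp.coeFn_toLp _

lemma bddSMul_sub (hb : AEStronglyMeasurable b μ) (hK : ∀ᵐ x ∂μ, |b x| ≤ K)
    (p q : Lp F 2 μ) : bddSMul hb hK p - bddSMul hb hK q = bddSMul hb hK (p - q) := by
  refine Lp.ext ?_
  filter_upwards [Lp.coeFn_sub (bddSMul hb hK p) (bddSMul hb hK q), coeFn_bddSMul hb hK p,
    coeFn_bddSMul hb hK q, coeFn_bddSMul hb hK (p - q), Lp.coeFn_sub p q] with x h1 h2 h3 h4 h5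
  rw [h1, h4, Pi.sub_apply, h2, h3, h5, Pi.sub_apply, smul_sub]

lemma norm_bddSMul_le (hb : AEStronglyMeasurable b μ) (hK : ∀ᵐ x ∂μ, |b x| ≤ K)
    (p : Lp F 2 μ) : ‖bddSMul hb hK p‖ ≤ K * ‖p‖ := by
  refine Lp.norm_le_mul_norm_of_ae_le_mul ?_
  filter_upwards [coeFn_bddSMul hb hK p, hK] with x h1 h2
  rw [h1, norm_smul]
  exact mul_le_mul_of_nonneg_right h2 (norm_nonneg _)

end L2

/-! ### Completeness of `H¹(Ω)` -/

variable {n : ℕ} {Ω : Set (E n)}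

/-- For a fixed test function both sides of the defining identity are inner products with fixed `L²`
functions, hence continuous in the pair. -/
lemma isClosed_setOf_isWeakGradient :
    IsClosed {w : WithLp 2 (L2 Ω × L2vec Ω) | IsWeakGradient w.fst w.snd} := by
  have h : {w : WithLp 2 (L2 Ω × L2vec Ω) | IsWeakGradient w.fst w.snd} =
      ⋂ (φ : E n → ℝ) (_ : ContDiff ℝ ∞ φ) (_ : HasCompactSupport φ) (_ : tsupport φ ⊆ Ω)
        (i : Fin n), {w : WithLp 2 (L2 Ω × L2vec Ω) |
          ∫ x in Ω, w.fst x * fderiv ℝ φ x (EuclideanSpace.single i 1)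
            = - ∫ x in Ω, w.snd x i * φ x} := by
    ext w
    simp [IsWeakGradient]
  rw [h]
  refine isClosed_iInter fun φ => isClosed_iInter fun hφ => isClosed_iInter fun hc =>
    isClosed_iInter fun _ => isClosed_iInter fun i => ?_
  have hd : Continuous fun x => fderiv ℝ φ x (EuclideanSpace.single i 1) :=
    (hφ.continuous_fderiv (by simp)).clm_apply continuous_const
  have m1 : MemLp (fun x => fderiv ℝ φ x (EuclideanSpace.single i 1)) 2 (volume.restrict Ω) :=
    hd.memLp_of_hasCompactSupport (hc.fderiv_apply (𝕜 := ℝ) _)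
  have hv : Continuous fun x => (EuclideanSpace.single i (φ x) : E n) := by
    have : (fun x => (EuclideanSpace.single i (φ x) : E n))
        = fun x => φ x • EuclideanSpace.single i (1 : ℝ) := by
      funext x
      ext j
      simp
    rw [this]
    exact hφ.continuous.smul continuous_const
  have m2 : MemLp (fun x => (EuclideanSpace.single i (φ x) : E n)) 2 (volume.restrict Ω) := by
    refine hv.memLp_of_hasCompactSupport (hc.mono fun x hx => ?_)
    intro h0
    exact hx (by simp [h0])
  have e1 : ∀ w : WithLp 2 (L2 Ω × L2vec Ω),
      ∫ x in Ω, w.fst x * fderiv ℝ φ x (EuclideanSpace.single i 1) = inner ℝ (m1.toLp _) w.fst := by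
    intro w
    rw [L2.inner_def]
    refine integral_congr_ae ?_
    filter_upwards [m1.coeFn_toLp] with x hx
    rw [hx]
    simp
  have e2 : ∀ w : WithLp 2 (L2 Ω × L2vec Ω),
      ∫ x in Ω, w.snd x i * φ x = inner ℝ (m2.toLp _) w.snd := by
    intro w
    rw [L2.inner_def]
    refine integral_congr_ae ?_
    filter_upwards [m2.coeFn_toLp] with x hx
    rw [hx, EuclideanSpace.inner_single_left]
    simp [mul_comm]
  simp_rw [e1, e2]
  refine isClosed_eq ?_ ?_
  · exact continuous_const.inner (WithLp.prod_continuous_ofLp 2 _ _).fst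
  · exact (continuous_const.inner (WithLp.prod_continuous_ofLp 2 _ _).snd).neg

instance : CompleteSpace (H1 Ω) :=
  (isClosed_setOf_isWeakGradient (Ω := Ω)).completeSpace_coe

/-- The map `u ↦ u`, `H¹(Ω) → L²(Ω)`. -/
noncomputable def fnL : H1 Ω →L[ℝ] L2 Ω :=
  (WithLp.fstL 2 ℝ (L2 Ω) (L2vec Ω)).comp (sobolev Ω).subtypeL

/-- The map `u ↦ ∇u`, `H¹(Ω) → L²(Ω; ℝⁿ)`. -/
noncomputable def gradL : H1 Ω →L[ℝ] L2vec Ω :=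
  (WithLp.sndL 2 ℝ (L2 Ω) (L2vec Ω)).comp (sobolev Ω).subtypeL

lemma gradL_apply (u : H1 Ω) : gradL u = u.grad := rfl

lemma H1.norm_sq (u : H1 Ω) : ‖u‖ ^ 2 = ‖u.fn‖ ^ 2 + ‖u.grad‖ ^ 2 :=
  WithLp.prod_norm_sq_eq_of_L2 u.1

lemma H1.norm_fn_le (u : H1 Ω) : ‖u.fn‖ ≤ ‖u‖ := by
  refine abs_le_of_sq_le_sq' ?_ (norm_nonneg u) |>.2
  rw [u.norm_sq]
  linarith [sq_nonneg ‖u.grad‖]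

lemma H1.norm_grad_le (u : H1 Ω) : ‖u.grad‖ ≤ ‖u‖ := by
  refine abs_le_of_sq_le_sq' ?_ (norm_nonneg u) |>.2
  rw [u.norm_sq]
  linarith [sq_nonneg ‖u.fn‖]

lemma H1.ext {u v : H1 Ω} (h : u.fn = v.fn) (h' : u.grad = v.grad) : u = v :=
  Subtype.ext (WithLp.ofLp_injective 2 (Prod.ext h h'))

/-- The element of `H¹(Ω)` with given function and weak gradient. -/
def H1.mk {u : L2 Ω} {p : L2vec Ω} (h : IsWeakGradient u p) : H1 Ω := ⟨WithLp.toLp 2 (u, p), h⟩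

lemma H1.tendsto_iff {ι : Type*} {l : Filter ι} {u : ι → H1 Ω} {v : H1 Ω} :
    Tendsto u l (𝓝 v) ↔ Tendsto (fun i => (u i).fn) l (𝓝 v.fn) ∧
      Tendsto (fun i => (u i).grad) l (𝓝 v.grad) := by
  constructor
  · intro h
    exact ⟨(fnL.continuous.tendsto v).comp h, (gradL.continuous.tendsto v).comp h⟩
  · rintro ⟨h1, h2⟩
    rw [tendsto_subtype_rng]
    exact ((WithLp.prod_continuous_toLp 2 _ _).tendsto _).comp (h1.prodMk_nhds h2)

/-! ### The Friedrichs inequality for traces -/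

lemma hasTrace_iff_mem_closure {u : H1 Ω} {g : L2bdry Ω} :
    HasTrace u g ↔ (u, g) ∈ closure (classicalTraces Ω : Set (H1 Ω × L2bdry Ω)) := by
  rw [HasTrace, traceGraph, ← SetLike.mem_coe, Submodule.topologicalClosure_coe]

lemma HasTrace.induction {P : Set (H1 Ω × L2bdry Ω)} (hcl : IsClosed P)
    (hP : (classicalTraces Ω : Set (H1 Ω × L2bdry Ω)) ⊆ P) {u : H1 Ω} {g : L2bdry Ω}
    (h : HasTrace u g) : (u, g) ∈ P :=
  closure_minimal hP hcl (hasTrace_iff_mem_closure.1 h)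

lemma isClosed_friedrichs (C D : ℝ) :
    IsClosed {q : H1 Ω × L2bdry Ω | ‖q.1.fn‖ ^ 2 ≤ C * ‖q.2‖ ^ 2 + D * ‖q.1.grad‖ ^ 2} := by
  have c1 : Continuous fun q : H1 Ω × L2bdry Ω => q.1.fn := fnL.continuous.comp continuous_fst
  have c2 : Continuous fun q : H1 Ω × L2bdry Ω => q.1.grad :=
    gradL.continuous.comp continuous_fst
  exact isClosed_le (c1.norm.pow 2) ((continuous_const.mul (continuous_snd.norm.pow 2)).add
    (continuous_const.mul (c2.norm.pow 2)))

/-- The inequality is a closed condition on `(u, g)`, so it need only be checked on the classical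
pairs that generate the trace relation. -/
lemma friedrichs {m : ℕ} {Ω : Set (E (m + 1))} (hΩ : IsOpen Ω) {R : ℝ} (hR0 : 0 ≤ R)
    (hR : Ω ⊆ Metric.closedBall 0 R) {u : H1 Ω} {g : L2bdry Ω} (h : HasTrace u g) :
    ‖u.fn‖ ^ 2 ≤ 4 * R * ‖g‖ ^ 2 + 8 * R ^ 2 * ‖u.grad‖ ^ 2 := by
  refine h.induction (isClosed_friedrichs (4 * R) (8 * R ^ 2)) ?_
  rintro ⟨u, g⟩ ⟨φ, hφ, h1, h2, h3⟩
  change ‖u.fn‖ ^ 2 ≤ 4 * R * ‖g‖ ^ 2 + 8 * R ^ 2 * ‖u.grad‖ ^ 2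
  have key := friedrichs_of_contDiff hΩ hR0 hR hφ
  have e1 : ∫⁻ x in Ω, ENNReal.ofReal (φ x ^ 2) = ENNReal.ofReal (‖u.fn‖ ^ 2) := by
    rw [ofReal_norm_sq_eq_lintegral]
    refine lintegral_congr_ae ?_
    filter_upwards [h1] with x hx
    rw [← hx, Real.norm_eq_abs, sq_abs]
  have e2 : ∫⁻ x, ENNReal.ofReal (φ x ^ 2) ∂(surface Ω) = ENNReal.ofReal (‖g‖ ^ 2) := by
    rw [ofReal_norm_sq_eq_lintegral]
    refine lintegral_congr_ae ?_
    filter_upwards [h3] with x hx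
    rw [← hx, Real.norm_eq_abs, sq_abs]
  have e3 : ∫⁻ x in Ω, ENNReal.ofReal (fderiv ℝ φ x (EuclideanSpace.single 0 1) ^ 2) ≤
      ENNReal.ofReal (‖u.grad‖ ^ 2) := by
    rw [ofReal_norm_sq_eq_lintegral]
    refine lintegral_mono_ae ?_
    filter_upwards [h2] with x hx
    refine ENNReal.ofReal_le_ofReal ?_
    rw [hx, gradient, LinearIsometryEquiv.norm_map, ← sq_abs]
    refine pow_le_pow_left₀ (abs_nonneg _) ?_ 2
    simpa using (fderiv ℝ φ x).le_opNorm (EuclideanSpace.single 0 1)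
  rw [e1, e2] at key
  have h4 : ENNReal.ofReal (‖u.fn‖ ^ 2) ≤ ENNReal.ofReal (4 * R) * ENNReal.ofReal (‖g‖ ^ 2) +
      ENNReal.ofReal (8 * R ^ 2) * ENNReal.ofReal (‖u.grad‖ ^ 2) := key.trans (by gcongr)
  rw [← ENNReal.ofReal_mul (by positivity), ← ENNReal.ofReal_mul (by positivity),
    ← ENNReal.ofReal_add (by positivity) (by positivity)] at h4
  exact (ENNReal.ofReal_le_ofReal_iff (by positivity)).1 h4

end

section

/-! ### Strongly monotone operators -/

/-- The map `x ↦ x - ρ N x` is a contraction for small `ρ`, and its fixed point is a zero of `N`. -/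
lemma exists_eq_zero_of_strongly_monotone {H : Type*} [NormedAddCommGroup H]
    [InnerProductSpace ℝ H] [CompleteSpace H] {N : H → H} {L m : ℝ} (hm : 0 < m)
    (hL : ∀ x y, ‖N x - N y‖ ≤ L * ‖x - y‖)
    (hmono : ∀ x y, m * ‖x - y‖ ^ 2 ≤ inner ℝ (N x - N y) (x - y)) : ∃ x, N x = 0 := by
  -- Enlarging the Lipschitz constant ensures `M > 0` and `m ≤ M`. The choice `ρ = m / M²` minimizes
  -- `1 - 2ρm + ρ²M²`, with value `1 - m²/M² ∈ [0, 1)`.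
  set M := |L| + m with hM
  have hM0 : 0 < M := by positivity
  have hM' : ∀ x y, ‖N x - N y‖ ≤ M * ‖x - y‖ := fun x y =>
    (hL x y).trans (mul_le_mul_of_nonneg_right (by linarith [le_abs_self L]) (norm_nonneg _))
  set ρ := m / M ^ 2 with hρ
  have hρ0 : 0 < ρ := by positivity
  have hk : 0 ≤ 1 - m ^ 2 / M ^ 2 := by
    rw [sub_nonneg, div_le_one (by positivity)]
    exact pow_le_pow_left₀ hm.le (by linarith [abs_nonneg L]) 2
  have hk1 : 1 - m ^ 2 / M ^ 2 < 1 := by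
    have : 0 < m ^ 2 / M ^ 2 := by positivity
    linarith
  have hstep : ∀ x y, ‖(x - ρ • N x) - (y - ρ • N y)‖ ≤ √(1 - m ^ 2 / M ^ 2) * ‖x - y‖ := by
    intro x y
    have e : (x - ρ • N x) - (y - ρ • N y) = (x - y) - ρ • (N x - N y) := by
      rw [smul_sub]
      abel
    refine abs_le_of_sq_le_sq' ?_ (by positivity) |>.2
    rw [e, norm_sub_sq_real, mul_pow, Real.sq_sqrt hk, inner_smul_right, norm_smul,
      real_inner_comm, mul_pow, Real.norm_eq_abs, sq_abs]
    have h1 := mul_le_mul_of_nonneg_left (hmono x y) hρ0.le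
    have h2 : ‖N x - N y‖ ^ 2 ≤ M ^ 2 * ‖x - y‖ ^ 2 := by
      rw [← mul_pow]
      exact pow_le_pow_left₀ (norm_nonneg _) (hM' x y) 2
    have h3 := mul_le_mul_of_nonneg_left h2 (sq_nonneg ρ)
    have h4 : ρ ^ 2 * M ^ 2 = ρ * m := by
      rw [hρ]
      field_simp
    have h5 : m ^ 2 / M ^ 2 = ρ * m := by
      rw [hρ]
      field_simp
    rw [h5]
    have h6 : ρ ^ 2 * (M ^ 2 * ‖x - y‖ ^ 2) = ρ * m * ‖x - y‖ ^ 2 := by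
      rw [← mul_assoc, h4]
    linarith
  have hc : ContractingWith (√(1 - m ^ 2 / M ^ 2)).toNNReal (fun x => x - ρ • N x) := by
    refine ⟨?_, LipschitzWith.of_dist_le_mul fun x y => ?_⟩
    · rw [Real.toNNReal_lt_one, Real.sqrt_lt' one_pos]
      simpa using hk1
    · rw [dist_eq_norm, dist_eq_norm, Real.coe_toNNReal _ (Real.sqrt_nonneg _)]
      exact hstep x y
  refine ⟨hc.fixedPoint, ?_⟩
  have h : hc.fixedPoint - ρ • N hc.fixedPoint = hc.fixedPoint := hc.fixedPoint_isFixedPt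
  rw [sub_eq_self, smul_eq_zero] at h
  exact h.resolve_left hρ0.ne'

/-! ### The Kirchhoff transform -/

lemma exists_kirchhoff {a : ℝ → ℝ} (ha : Continuous a) {α : ℝ} (hα : 0 < α) (h : ∀ t, α ≤ a t) :
    ∃ A B : ℝ → ℝ, (∀ t, HasDerivAt A (a t) t) ∧ (∀ t, HasDerivAt B (a (B t))⁻¹ t) ∧
      A 0 = 0 ∧ B 0 = 0 ∧ (∀ t, A (B t) = t) ∧ ∀ t, B (A t) = t := by
  set A : ℝ → ℝ := fun t => ∫ s in (0 : ℝ)..t, a s with hAdef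
  have hA : ∀ t, HasDerivAt A (a t) t := fun t =>
    intervalIntegral.integral_hasDerivAt_right (ha.intervalIntegrable _ _)
      (ha.stronglyMeasurableAtFilter _ _) ha.continuousAt
  have hA0 : A 0 = 0 := intervalIntegral.integral_same
  have hsm : StrictMono A := strictMono_of_deriv_pos fun t => by
    rw [(hA t).deriv]
    exact hα.trans_le (h t)
  -- Comparison with the line `αt` forces `A` to `±∞` at both ends, so `A` is onto.
  have hmono : Monotone fun t => A t - α * t := by
    have hd : ∀ t, HasDerivAt (fun t => A t - α * t) (a t - α) t := fun t => by
      have h1 := (hA t).sub ((hasDerivAt_id t).const_mul α)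
      rw [mul_one] at h1
      exact h1
    refine monotone_of_deriv_nonneg (fun t => (hd t).differentiableAt) fun t => ?_
    rw [(hd t).deriv]
    linarith [h t]
  have htop : Tendsto A atTop atTop := by
    refine tendsto_atTop_mono' _ ?_ (tendsto_id.const_mul_atTop hα)
    filter_upwards [eventually_ge_atTop 0] with t ht
    have := hmono ht
    simp only [hA0, id] at this ⊢
    linarith
  have hbot : Tendsto A atBot atBot := by
    refine tendsto_atBot_mono' _ ?_ (tendsto_id.const_mul_atBot hα)
    filter_upwards [eventually_le_atBot 0] with t ht
    have := hmono ht
    simp only [hA0, id] at this ⊢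
    linarith
  have hcont : Continuous A := continuous_iff_continuousAt.2 fun t => (hA t).continuousAt
  set e := hsm.orderIsoOfSurjective A (hcont.surjective htop hbot) with he
  have hAB : ∀ t, A (e.symm t) = t := fun t => e.apply_symm_apply t
  have hBA : ∀ t, e.symm (A t) = t := fun t => e.symm_apply_apply t
  refine ⟨A, e.symm, hA, fun t => ?_, hA0, ?_, hAB, hBA⟩
  · exact HasDerivAt.of_local_left_inverse e.symm.continuous.continuousAt (hA _)
      (hα.trans_le (h _)).ne' (Eventually.of_forall hAB)
  · rw [← hA0]
    exact (hBA 0).trans hA0.symm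

lemma lipschitzWith_of_hasDerivAt {a A : ℝ → ℝ} (hA : ∀ t, HasDerivAt A (a t) t) {K : NNReal}
    (haK : ∀ t, |a t| ≤ K) : LipschitzWith K A :=
  lipschitzWith_of_nnnorm_deriv_le (fun t => (hA t).differentiableAt) fun t => by
    rw [(hA t).deriv, ← NNReal.coe_le_coe]
    exact haK t

/-! ### The chain rule -/

section CompSMul

variable {X F : Type*} [MeasurableSpace X] {μ : Measure X} [NormedAddCommGroup F]
  [InnerProductSpace ℝ F] {a : ℝ → ℝ} {K : ℝ}

/-- The product `a(u) p`. -/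
noncomputable def compSMul (ha : Continuous a) (haK : ∀ t, |a t| ≤ K) (u : Lp ℝ 2 μ)
    (p : Lp F 2 μ) : Lp F 2 μ :=
  bddSMul (b := fun x => a (u x)) (K := K)
    (ha.comp_aestronglyMeasurable (Lp.aestronglyMeasurable u)) (ae_of_all _ fun _ => haK _) p

lemma coeFn_compSMul (ha : Continuous a) (haK : ∀ t, |a t| ≤ K) (u : Lp ℝ 2 μ) (p : Lp F 2 μ) :
    compSMul ha haK u p =ᵐ[μ] fun x => a (u x) • p x := coeFn_bddSMul _ _ _

/-- The index may be a real parameter, so uncountably many null sets cannot be discarded together.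
The pointwise limit is therefore required of prescribed representatives `φ i`. -/
lemma tendsto_compSMul_left {ι : Type*} {l : Filter ι} [l.IsCountablyGenerated]
    (ha : Continuous a) (haK : ∀ t, |a t| ≤ K) {u : ι → Lp ℝ 2 μ} {v : Lp ℝ 2 μ} (p : Lp F 2 μ)
    {φ : ι → X → ℝ} (hφ : ∀ i, u i =ᵐ[μ] φ i)
    (h : ∀ᵐ x ∂μ, Tendsto (fun i => φ i x) l (𝓝 (v x))) :
    Tendsto (fun i => compSMul ha haK (u i) p) l (𝓝 (compSMul ha haK v p)) := by
  refine tendsto_L2_of_dominated (b := fun x => 2 * K * ‖p x‖) (φ := fun i x => a (φ i x) • p x)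
    ?_ (Eventually.of_forall fun i => ?_) (fun i => ?_) ?_
  · simp_rw [mul_pow]
    exact (integrable_norm_sq p).const_mul _
  · filter_upwards [coeFn_compSMul ha haK (u i) p, coeFn_compSMul ha haK v p] with x h1 h2
    rw [h1, h2, ← sub_smul, norm_smul]
    refine mul_le_mul_of_nonneg_right ?_ (norm_nonneg _)
    refine (norm_sub_le _ _).trans ?_
    have h3 := haK (u i x)
    have h4 := haK (v x)
    simp only [Real.norm_eq_abs]
    linarith
  · filter_upwards [coeFn_compSMul ha haK (u i) p, hφ i] with x h1 h2
    rw [h1, h2]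
  · filter_upwards [h, coeFn_compSMul ha haK v p] with x h1 h2
    rw [h2]
    exact ((ha.tendsto _).comp h1).smul_const _

/-- Split the error as `a(uᵢ)(pᵢ - q) + (a(uᵢ) - a(v))q`: the first term is small since `a` is
bounded, the second by dominated convergence. -/
lemma tendsto_compSMul (ha : Continuous a) (haK : ∀ t, |a t| ≤ K) {u : ℕ → Lp ℝ 2 μ}
    {v : Lp ℝ 2 μ} {p : ℕ → Lp F 2 μ} {q : Lp F 2 μ}
    (h : ∀ᵐ x ∂μ, Tendsto (fun i => u i x) atTop (𝓝 (v x))) (hp : Tendsto p atTop (𝓝 q)) :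
    Tendsto (fun i => compSMul ha haK (u i) (p i)) atTop (𝓝 (compSMul ha haK v q)) := by
  have h1 := tendsto_compSMul_left ha haK q (fun i => ae_eq_refl (u i)) h
  have h2 : Tendsto (fun i => compSMul ha haK (u i) (p i) - compSMul ha haK (u i) q) atTop
      (𝓝 0) := by
    refine squeeze_zero_norm (a := fun i => K * ‖p i - q‖) (fun i => ?_) ?_
    · rw [compSMul, compSMul, bddSMul_sub]
      exact norm_bddSMul_le _ _ _
    · simpa using (tendsto_iff_norm_sub_tendsto_zero.1 hp).const_mul K
  simpa using h2.add h1

end CompSMul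

variable {n : ℕ} {Ω : Set (E n)}

lemma gradient_apply_coord (φ : E n → ℝ) (x : E n) (i : Fin n) :
    gradient φ x i = fderiv ℝ φ x (EuclideanSpace.single i 1) := by
  have h : inner ℝ (gradient φ x) (EuclideanSpace.single i (1 : ℝ))
      = fderiv ℝ φ x (EuclideanSpace.single i 1) := InnerProductSpace.toDual_symm_apply
  rw [← h, EuclideanSpace.inner_single_right]
  simp

/-- Since the test function is supported in `Ω`, both integrals extend to the whole space, where
integration by parts has no boundary term. -/
lemma isWeakGradient_of_contDiff {ψ : E n → ℝ} (hψ : ContDiff ℝ 1 ψ) {u : L2 Ω} {p : L2vec Ω}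
    (hu : ∀ᵐ x ∂(volume.restrict Ω), u x = ψ x)
    (hp : ∀ᵐ x ∂(volume.restrict Ω), p x = gradient ψ x) : IsWeakGradient u p := by
  intro φ hφ hc hs i
  have hd : Continuous fun x => fderiv ℝ φ x (EuclideanSpace.single i 1) :=
    (hφ.continuous_fderiv (by simp)).clm_apply continuous_const
  have hdc : HasCompactSupport fun x => fderiv ℝ φ x (EuclideanSpace.single i 1) :=
    hc.fderiv_apply (𝕜 := ℝ) _
  have hdψ : Continuous fun x => fderiv ℝ ψ x (EuclideanSpace.single i 1) :=
    (hψ.continuous_fderiv (by simp)).clm_apply continuous_const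
  have e1 : ∫ x in Ω, u x * fderiv ℝ φ x (EuclideanSpace.single i 1)
      = ∫ x, ψ x * fderiv ℝ φ x (EuclideanSpace.single i 1) := by
    refine Eq.trans (b := ∫ x in Ω, ψ x * fderiv ℝ φ x (EuclideanSpace.single i 1)) ?_
      (setIntegral_eq_integral_of_forall_compl_eq_zero ?_)
    · refine integral_congr_ae ?_
      filter_upwards [hu] with x hx
      rw [hx]
    · intro x hx
      have : x ∉ tsupport (fderiv ℝ φ) := fun h => hx (hs (tsupport_fderiv_subset ℝ h))
      rw [image_eq_zero_of_notMem_tsupport this]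
      simp
  have e2 : ∫ x in Ω, p x i * φ x
      = ∫ x, fderiv ℝ ψ x (EuclideanSpace.single i 1) * φ x := by
    refine Eq.trans (b := ∫ x in Ω, fderiv ℝ ψ x (EuclideanSpace.single i 1) * φ x) ?_
      (setIntegral_eq_integral_of_forall_compl_eq_zero ?_)
    · refine integral_congr_ae ?_
      filter_upwards [hp] with x hx
      rw [hx, gradient_apply_coord]
    · intro x hx
      rw [image_eq_zero_of_notMem_tsupport (fun h => hx (hs h)), mul_zero]
  rw [e1, e2]
  refine integral_mul_fderiv_eq_neg_fderiv_mul_of_integrable ?_ ?_ ?_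
    (fun x _ => hψ.differentiable (by simp) x) (fun x _ => hφ.differentiable (by simp) x)
  · exact (hdψ.mul hφ.continuous).integrable_of_hasCompactSupport hc.mul_left
  · exact (hψ.continuous.mul hd).integrable_of_hasCompactSupport hdc.mul_left
  · exact (hψ.continuous.mul hφ.continuous).integrable_of_hasCompactSupport hc.mul_left

variable {a A : ℝ → ℝ} {K : NNReal}

lemma chain_classical (ha : Continuous a) (hA : ∀ t, HasDerivAt A (a t) t)
    (haK : ∀ t, |a t| ≤ K) (hA0 : A 0 = 0) {q : H1 Ω × L2bdry Ω} (hq : q ∈ classicalTraces Ω) :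
    ∃ U : H1 Ω, U.fn = (lipschitzWith_of_hasDerivAt hA haK).compLp hA0 q.1.fn ∧
      U.grad = compSMul ha haK q.1.fn q.1.grad ∧
      (U, (lipschitzWith_of_hasDerivAt hA haK).compLp hA0 q.2) ∈ classicalTraces Ω := by
  obtain ⟨φ, hφ, h1, h2, h3⟩ := hq
  have hAC : ContDiff ℝ 1 A := by
    rw [contDiff_one_iff_deriv]
    refine ⟨fun t => (hA t).differentiableAt, ?_⟩
    rw [funext fun t => (hA t).deriv]
    exact ha
  have hgrad : ∀ x, gradient (fun x => A (φ x)) x = a (φ x) • gradient φ x := by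
    intro x
    have := (hA (φ x)).comp_hasFDerivAt x (hφ.differentiable (by simp) x).hasFDerivAt
    have h4 : fderiv ℝ (fun x => A (φ x)) x = a (φ x) • fderiv ℝ φ x := this.fderiv
    rw [gradient, h4, map_smul, gradient]
  have e1 : ∀ᵐ x ∂(volume.restrict Ω),
      (lipschitzWith_of_hasDerivAt hA haK).compLp hA0 q.1.fn x = A (φ x) := by
    filter_upwards [(lipschitzWith_of_hasDerivAt hA haK).coeFn_compLp hA0 q.1.fn, h1] with x h h'
    rw [h, Function.comp_apply, h']
  have e2 : ∀ᵐ x ∂(volume.restrict Ω),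
      compSMul ha haK q.1.fn q.1.grad x = gradient (fun x => A (φ x)) x := by
    filter_upwards [coeFn_compSMul ha haK q.1.fn q.1.grad, h1, h2] with x h h' h''
    rw [h, h', h'', hgrad]
  have e3 : ∀ᵐ x ∂(surface Ω),
      (lipschitzWith_of_hasDerivAt hA haK).compLp hA0 q.2 x = A (φ x) := by
    filter_upwards [(lipschitzWith_of_hasDerivAt hA haK).coeFn_compLp hA0 q.2, h3] with x h h'
    rw [h, Function.comp_apply, h']
  exact ⟨H1.mk (isWeakGradient_of_contDiff (hAC.comp hφ) e1 e2), rfl, rfl,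
    fun x => A (φ x), hAC.comp hφ, e1, e2, e3⟩

/-- The chain rule `∇A(u) = a(u)∇u`, with `A(u)|_∂Ω = A(u|_∂Ω)`, for `A ∈ C¹` with bounded
derivative `a` and `A(0) = 0`. -/
lemma chain (ha : Continuous a) (hA : ∀ t, HasDerivAt A (a t) t) (haK : ∀ t, |a t| ≤ K)
    (hA0 : A 0 = 0) {u : H1 Ω} {g : L2bdry Ω} (h : HasTrace u g) :
    ∃ U : H1 Ω, U.fn = (lipschitzWith_of_hasDerivAt hA haK).compLp hA0 u.fn ∧
      U.grad = compSMul ha haK u.fn u.grad ∧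
      HasTrace U ((lipschitzWith_of_hasDerivAt hA haK).compLp hA0 g) := by
  obtain ⟨q, hq, hlim⟩ := mem_closure_iff_seq_limit.1 (hasTrace_iff_mem_closure.1 h)
  have hlim1 : Tendsto (fun k => (q k).1) atTop (𝓝 u) := (continuous_fst.tendsto _).comp hlim
  have hlim2 : Tendsto (fun k => (q k).2) atTop (𝓝 g) := (continuous_snd.tendsto _).comp hlim
  obtain ⟨hfn, hgr⟩ := H1.tendsto_iff.1 hlim1
  -- As `a` is merely continuous, convergence of `a(uₖ)∇uₖ` needs `uₖ → u` almost everywhere, which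
  -- holds along a subsequence.
  obtain ⟨ns, hns, hae⟩ := (tendstoInMeasure_of_tendsto_Lp hfn).exists_seq_tendsto_ae
  choose U hU1 hU2 hU3 using fun k => chain_classical ha hA haK hA0 (hq k)
  have t1 : Tendsto (fun k => (U (ns k)).fn) atTop
      (𝓝 ((lipschitzWith_of_hasDerivAt hA haK).compLp hA0 u.fn)) := by
    simp_rw [hU1]
    exact (((lipschitzWith_of_hasDerivAt hA haK).continuous_compLp hA0).tendsto _).comp
      (hfn.comp hns.tendsto_atTop)
  have t2 : Tendsto (fun k => (U (ns k)).grad) atTop (𝓝 (compSMul ha haK u.fn u.grad)) := by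
    simp_rw [hU2]
    exact tendsto_compSMul ha haK hae (hgr.comp hns.tendsto_atTop)
  have hw : IsWeakGradient ((lipschitzWith_of_hasDerivAt hA haK).compLp hA0 u.fn)
      (compSMul ha haK u.fn u.grad) :=
    (isClosed_setOf_isWeakGradient (Ω := Ω)).mem_of_tendsto
      (((WithLp.prod_continuous_toLp 2 _ _).tendsto _).comp (t1.prodMk_nhds t2))
      (Eventually.of_forall fun k => (U (ns k)).2)
  refine ⟨H1.mk hw, rfl, rfl, hasTrace_iff_mem_closure.2 ?_⟩
  refine mem_closure_of_tendsto (Tendsto.prodMk_nhds (H1.tendsto_iff.2 ⟨t1, t2⟩) ?_)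
    (Eventually.of_forall fun k => hU3 (ns k))
  exact (((lipschitzWith_of_hasDerivAt hA haK).continuous_compLp hA0).tendsto _).comp
    (hlim2.comp hns.tendsto_atTop)

end

/-! ### Transform pairs and the boundary value problem -/

section

/-- `A` is a primitive of the positive bounded function `a`, and `B` is the inverse of `A`. -/
structure IsKirchhoffPair (a A B : ℝ → ℝ) (K : NNReal) : Prop where
  cont : Continuous a
  pos : ∀ t, 0 < a t
  bound : ∀ t, |a t| ≤ K
  bound_inv : ∀ t, |(a (B t))⁻¹| ≤ K
  hasDerivAt : ∀ t, HasDerivAt A (a t) t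
  hasDerivAt_inv : ∀ t, HasDerivAt B (a (B t))⁻¹ t
  map_zero : A 0 = 0
  inv_zero : B 0 = 0
  apply_inv : ∀ t, A (B t) = t
  inv_apply : ∀ t, B (A t) = t

namespace IsKirchhoffPair

variable {a A B : ℝ → ℝ} {K : NNReal} (h : IsKirchhoffPair a A B K)
include h

lemma lipschitz : LipschitzWith K A := lipschitzWith_of_hasDerivAt h.hasDerivAt h.bound

lemma lipschitz_inv : LipschitzWith K B := lipschitzWith_of_hasDerivAt h.hasDerivAt_inv h.bound_inv

lemma cont_inv : Continuous fun t => (a (B t))⁻¹ :=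
  (h.cont.comp h.lipschitz_inv.continuous).inv₀ fun _ => (h.pos _).ne'

lemma monotone : Monotone A := monotone_of_deriv_nonneg (fun t => (h.hasDerivAt t).differentiableAt)
  fun t => by
    rw [(h.hasDerivAt t).deriv]
    exact (h.pos t).le

lemma mul_sub_nonneg (s t : ℝ) : 0 ≤ (s - t) * (A s - A t) := by
  rcases le_total s t with hst | hst
  · exact mul_nonneg_of_nonpos_of_nonpos (sub_nonpos.2 hst) (sub_nonpos.2 (h.monotone hst))
  · exact mul_nonneg (sub_nonneg.2 hst) (sub_nonneg.2 (h.monotone hst))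

lemma abs_sub_le (s t : ℝ) : |s - t| ≤ K * |A s - A t| := by
  have h1 := h.lipschitz_inv.dist_le_mul (A s) (A t)
  rwa [h.inv_apply, h.inv_apply, Real.dist_eq, Real.dist_eq] at h1

end IsKirchhoffPair

variable {n : ℕ} {Ω : Set (E n)} {a A B : ℝ → ℝ} {c : E n → ℝ} {K : NNReal}

lemma Admissible.exists_isKirchhoffPair (h : Admissible Ω a c) :
    ∃ (A B : ℝ → ℝ) (K : NNReal), IsKirchhoffPair a A B K ∧
      (∀ᵐ x ∂(volume.restrict Ω), 0 ≤ c x) ∧ ∀ᵐ x ∂(volume.restrict Ω), |c x| ≤ K := by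
  obtain ⟨ha, -, α, hα, haα, hcα⟩ := h
  obtain ⟨A, B, h1, h2, h3, h4, h5, h6⟩ := exists_kirchhoff ha hα fun t => (haα t).1
  have hpos : ∀ t, 0 < a t := fun t => hα.trans_le (haα t).1
  -- The single constant `1/α` bounds `a`, `1/a` and `c`.
  have hK : ((1 / α).toNNReal : ℝ) = 1 / α := Real.coe_toNNReal _ (by positivity)
  refine ⟨A, B, (1 / α).toNNReal, ⟨ha, hpos, fun t => ?_, fun t => ?_, h1, h2, h3, h4, h5, h6⟩,
    hcα.mono fun x hx => hx.1, hcα.mono fun x hx => ?_⟩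
  · rw [hK, abs_of_pos (hpos t)]
    exact (haα t).2
  · rw [hK, abs_of_pos (inv_pos.2 (hpos _)), one_div]
    exact inv_anti₀ hα (haα _).1
  · rw [hK, abs_of_nonneg hx.1]
    exact hx.2

/-- Makes the linear problem an instance of the quasilinear one, so that solvability and co-normal
derivatives are treated once. -/
lemma Admissible.const (h : Admissible Ω a c) (t : ℝ) : Admissible Ω (fun _ => a t) c := by
  obtain ⟨-, hc, α, hα, haα, hcα⟩ := h
  exact ⟨continuous_const, hc, α, hα, fun _ => haα t, hcα⟩

lemma inner_nonneg_of_ae {X : Type*} [MeasurableSpace X] {μ : Measure X} {p q : Lp ℝ 2 μ}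
    (h : ∀ᵐ x ∂μ, 0 ≤ p x * q x) : 0 ≤ (inner ℝ p q : ℝ) := by
  rw [L2.inner_def]
  refine integral_nonneg_of_ae ?_
  filter_upwards [h] with x hx
  simpa [mul_comm] using hx

/-- The flux `p` is left free so that it can be the gradient of the transform `A(u)` as well as the
product `a(u)∇u`. -/
lemma form_eq_inner {u v : H1 Ω} {p : L2vec Ω}
    (hp : p =ᵐ[volume.restrict Ω] fun x => a (u.fn x) • u.grad x)
    (hc : AEStronglyMeasurable c (volume.restrict Ω))
    (hcK : ∀ᵐ x ∂(volume.restrict Ω), |c x| ≤ K) :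
    form a c u v = inner ℝ p v.grad + inner ℝ (bddSMul hc hcK u.fn) v.fn := by
  rw [L2.inner_def, L2.inner_def, ← integral_add (L2.integrable_inner _ _) (L2.integrable_inner _ _),
    form]
  refine integral_congr_ae ?_
  filter_upwards [hp, coeFn_bddSMul hc hcK u.fn] with x h1 h2
  rw [h1, h2, real_inner_smul_left]
  simp [mul_comm]

/-! ### Unique solvability -/

lemma HasTrace.sub {u v : H1 Ω} {g g' : L2bdry Ω} (h : HasTrace u g) (h' : HasTrace v g') :
    HasTrace (u - v) (g - g') := (traceGraph Ω).sub_mem h h'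

lemma HasTrace.add {u v : H1 Ω} {g g' : L2bdry Ω} (h : HasTrace u g) (h' : HasTrace v g') :
    HasTrace (u + v) (g + g') := (traceGraph Ω).add_mem h h'

lemma HasTrace.smul {u : H1 Ω} {g : L2bdry Ω} (r : ℝ) (h : HasTrace u g) :
    HasTrace (r • u) (r • g) := (traceGraph Ω).smul_mem r h

/-- The functions in `H¹(Ω)` with vanishing trace. -/
noncomputable def zeroTrace (Ω : Set (E n)) : Submodule ℝ (H1 Ω) :=
  (traceGraph Ω).comap (LinearMap.inl ℝ (H1 Ω) (L2bdry Ω))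

lemma isClosed_zeroTrace : IsClosed (zeroTrace Ω : Set (H1 Ω)) :=
  (Submodule.isClosed_topologicalClosure (classicalTraces Ω)).preimage
    (f := fun v : H1 Ω => (v, (0 : L2bdry Ω))) (by fun_prop)

/-- The Poincaré inequality for functions with vanishing trace. -/
def HasPoincare (Ω : Set (E n)) (C : ℝ) : Prop :=
  ∀ v : H1 Ω, HasTrace v 0 → ‖v.fn‖ ≤ C * ‖v.grad‖

lemma IsPiecewiseC1Domain.exists_hasPoincare (hn : n ≠ 0) (hΩ : IsPiecewiseC1Domain Ω) :
    ∃ C, 0 ≤ C ∧ HasPoincare Ω C := by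
  obtain ⟨m, rfl⟩ := Nat.exists_eq_succ_of_ne_zero hn
  obtain ⟨R, hR⟩ := hΩ.isBounded.subset_closedBall 0
  have hR' : Ω ⊆ Metric.closedBall 0 |R| :=
    hR.trans (Metric.closedBall_subset_closedBall (le_abs_self R))
  refine ⟨√8 * |R|, by positivity, fun v hv => ?_⟩
  have h := friedrichs hΩ.isOpen (abs_nonneg R) hR' hv
  refine abs_le_of_sq_le_sq' ?_ (by positivity) |>.2
  rw [mul_pow, mul_pow, Real.sq_sqrt (by norm_num)]
  simpa using h

/-- If `u` has trace `g`, then `A(u)` has gradient `a(u)∇u` and trace `A(g)`. -/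
lemma IsKirchhoffPair.exists_transform (h : IsKirchhoffPair a A B K) {u : H1 Ω} {g : L2bdry Ω}
    (hu : HasTrace u g) : ∃ U : H1 Ω, U.fn =ᵐ[volume.restrict Ω] (fun x => A (u.fn x)) ∧
      U.grad =ᵐ[volume.restrict Ω] (fun x => a (u.fn x) • u.grad x) ∧
      HasTrace U (h.lipschitz.compLp h.map_zero g) := by
  obtain ⟨U, h1, h2, h3⟩ := chain h.cont h.hasDerivAt h.bound h.map_zero hu
  refine ⟨U, ?_, ?_, h3⟩
  · rw [h1]
    exact h.lipschitz.coeFn_compLp h.map_zero u.fn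
  · rw [h2]
    exact coeFn_compSMul _ _ _ _

/-- Both equations are tested with `A(u) - A(v)`, not `u - v`: the flux term becomes `‖∇(A(u) -
A(v))‖²`, and the other, `∫ c (u - v)(A(u) - A(v))`, is nonnegative by monotonicity. Poincaré and
injectivity of `A` finish. -/
lemma IsWeakSolution.unique {C : ℝ} (hP : HasPoincare Ω C)
    (h : IsKirchhoffPair a A B K) (hc : AEStronglyMeasurable c (volume.restrict Ω))
    (hc0 : ∀ᵐ x ∂(volume.restrict Ω), 0 ≤ c x) (hcK : ∀ᵐ x ∂(volume.restrict Ω), |c x| ≤ K)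
    {g : HHalf Ω} {u v : H1 Ω} (hu : IsWeakSolution a c g u) (hv : IsWeakSolution a c g v) :
    u = v := by
  obtain ⟨U, U1, U2, U3⟩ := h.exists_transform hu.1
  obtain ⟨V, V1, V2, V3⟩ := h.exists_transform hv.1
  have hW : HasTrace (U - V) 0 := by simpa using U3.sub V3
  have e1 := hu.2 _ hW
  have e2 := hv.2 _ hW
  rw [form_eq_inner U2 hc hcK] at e1
  rw [form_eq_inner V2 hc hcK] at e2
  have hWg : (U - V).grad = U.grad - V.grad := rfl
  have hWf : (U - V).fn = U.fn - V.fn := rfl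
  have e3 : inner ℝ (U - V).grad (U - V).grad +
      inner ℝ (bddSMul hc hcK (u.fn - v.fn)) (U - V).fn = 0 := by
    nth_rewrite 1 [hWg]
    rw [← bddSMul_sub, inner_sub_left, inner_sub_left]
    linarith
  have e4 : 0 ≤ (inner ℝ (bddSMul hc hcK (u.fn - v.fn)) (U - V).fn : ℝ) := by
    refine inner_nonneg_of_ae ?_
    rw [hWf]
    filter_upwards [coeFn_bddSMul hc hcK (u.fn - v.fn), Lp.coeFn_sub u.fn v.fn,
      Lp.coeFn_sub U.fn V.fn, U1, V1, hc0] with x h1 h2 h3 h4 h5 h6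
    rw [h1, h2, h3, Pi.sub_apply, Pi.sub_apply, h4, h5, smul_eq_mul, mul_assoc]
    exact mul_nonneg h6 (h.mul_sub_nonneg _ _)
  rw [real_inner_self_eq_norm_sq] at e3
  have e5 : ‖(U - V).grad‖ = 0 := by nlinarith [norm_nonneg (U - V).grad]
  have e6 : ‖(U - V).fn‖ = 0 := by
    have := hP _ hW
    rw [e5, mul_zero] at this
    exact le_antisymm this (norm_nonneg _)
  have e7 : U.fn = V.fn := by rwa [hWf, norm_sub_eq_zero_iff] at e6
  have e8 : U.grad = V.grad := by rwa [hWg, norm_sub_eq_zero_iff] at e5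
  rw [e7] at U1
  rw [e8] at U2
  have e9 : u.fn = v.fn := by
    refine Lp.ext ?_
    filter_upwards [U1, V1] with x h1 h2
    rw [← h.inv_apply (u.fn x), ← h.inv_apply (v.fn x), ← h1, ← h2]
  refine H1.ext e9 (Lp.ext ?_)
  filter_upwards [U2, V2] with x h1 h2
  rw [h1, e9] at h2
  exact smul_right_injective _ (h.pos (v.fn x)).ne' h2

/-- A semilinear variational problem with a monotone Lipschitz nonlinearity. -/
lemma exists_variational_solution {H V W : Type*} [NormedAddCommGroup H] [InnerProductSpace ℝ H]
    [CompleteSpace H] [NormedAddCommGroup V] [InnerProductSpace ℝ V] [CompleteSpace V]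
    [NormedAddCommGroup W] [InnerProductSpace ℝ W] [CompleteSpace W] (G : H →L[ℝ] V) (J : H →L[ℝ] W)
    {S : W → W} {L m : ℝ} (hL : 0 ≤ L) (hm : 0 < m) (hcoer : ∀ d, m * ‖d‖ ^ 2 ≤ ‖G d‖ ^ 2)
    (hS : ∀ f f', ‖S f - S f'‖ ≤ L * ‖f - f'‖)
    (hmono : ∀ f f', 0 ≤ (inner ℝ (S f - S f') (f - f') : ℝ)) (p : V) (f : W) :
    ∃ w, ∀ v, (inner ℝ (p + G w) (G v) + inner ℝ (S (f + J w)) (J v) : ℝ) = 0 := by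
  -- The Riesz representative of the left-hand side as a functional of `v`. Coercivity of `G` alone
  -- gives strong monotonicity; `S` contributes a nonnegative term.
  set N : H → H := fun w => G.adjoint (p + G w) + J.adjoint (S (f + J w)) with hN
  have hdiff : ∀ x y, N x - N y =
      G.adjoint (G (x - y)) + J.adjoint (S (f + J x) - S (f + J y)) := by
    intro x y
    simp only [hN, map_add, map_sub]
    abel
  have hJ : ∀ x y, J (x - y) = (f + J x) - (f + J y) := fun x y => by
    rw [map_sub]
    abel
  obtain ⟨w, hw⟩ := exists_eq_zero_of_strongly_monotone (N := N)
    (L := ‖G.adjoint‖ * ‖G‖ + ‖J.adjoint‖ * (L * ‖J‖)) (m := m) hm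
    (fun x y => by
      rw [hdiff]
      refine (norm_add_le _ _).trans ?_
      rw [add_mul]
      refine add_le_add ?_ ?_
      · refine (G.adjoint.le_opNorm _).trans ?_
        rw [mul_assoc]
        exact mul_le_mul_of_nonneg_left (G.le_opNorm _) (norm_nonneg _)
      · refine (J.adjoint.le_opNorm _).trans ?_
        rw [mul_assoc]
        refine mul_le_mul_of_nonneg_left ((hS _ _).trans ?_) (norm_nonneg _)
        rw [mul_assoc, ← hJ]
        exact mul_le_mul_of_nonneg_left (J.le_opNorm _) hL)
    (fun x y => by
      rw [hdiff, inner_add_left, ContinuousLinearMap.adjoint_inner_left,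
        ContinuousLinearMap.adjoint_inner_left, real_inner_self_eq_norm_sq]
      have := hmono (f + J x) (f + J y)
      rw [← hJ] at this
      linarith [hcoer (x - y)])
  refine ⟨w, fun v => ?_⟩
  have h1 : inner ℝ (N w) v = (0 : ℝ) := by rw [hw, inner_zero_left]
  rwa [hN, inner_add_left, ContinuousLinearMap.adjoint_inner_left,
    ContinuousLinearMap.adjoint_inner_left] at h1

lemma exists_variational_solution_mem {H V W : Type*} [NormedAddCommGroup H]
    [InnerProductSpace ℝ H] [CompleteSpace H] [NormedAddCommGroup V] [InnerProductSpace ℝ V]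
    [CompleteSpace V] [NormedAddCommGroup W] [InnerProductSpace ℝ W] [CompleteSpace W]
    (Z : Submodule ℝ H) (hZ : IsClosed (Z : Set H)) (G : H →L[ℝ] V) (J : H →L[ℝ] W)
    {S : W → W} {L m : ℝ} (hL : 0 ≤ L) (hm : 0 < m) (hcoer : ∀ d ∈ Z, m * ‖d‖ ^ 2 ≤ ‖G d‖ ^ 2)
    (hS : ∀ f f', ‖S f - S f'‖ ≤ L * ‖f - f'‖)
    (hmono : ∀ f f', 0 ≤ (inner ℝ (S f - S f') (f - f') : ℝ)) (p : V) (f : W) :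
    ∃ w ∈ Z, ∀ v ∈ Z, (inner ℝ (p + G w) (G v) + inner ℝ (S (f + J w)) (J v) : ℝ) = 0 := by
  have : CompleteSpace Z := hZ.completeSpace_coe
  obtain ⟨w, hw⟩ := exists_variational_solution (G.comp Z.subtypeL) (J.comp Z.subtypeL) hL hm
    (fun d => hcoer d d.2) hS hmono p f
  exact ⟨w, w.2, fun v hv => hw ⟨v, hv⟩⟩

/-- The nonlinearity `f ↦ c B(f)` is monotone on `L²(Ω)`. -/
lemma IsKirchhoffPair.inner_bddSMul_sub_nonneg (h : IsKirchhoffPair a A B K)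
    (hc : AEStronglyMeasurable c (volume.restrict Ω))
    (hc0 : ∀ᵐ x ∂(volume.restrict Ω), 0 ≤ c x) (hcK : ∀ᵐ x ∂(volume.restrict Ω), |c x| ≤ K)
    (f f' : L2 Ω) :
    0 ≤ (inner ℝ (bddSMul hc hcK (h.lipschitz_inv.compLp h.inv_zero f) -
      bddSMul hc hcK (h.lipschitz_inv.compLp h.inv_zero f')) (f - f') : ℝ) := by
  rw [bddSMul_sub]
  refine inner_nonneg_of_ae ?_
  filter_upwards [coeFn_bddSMul hc hcK (h.lipschitz_inv.compLp h.inv_zero f -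
      h.lipschitz_inv.compLp h.inv_zero f'),
    Lp.coeFn_sub (h.lipschitz_inv.compLp h.inv_zero f) (h.lipschitz_inv.compLp h.inv_zero f'),
    Lp.coeFn_sub f f', h.lipschitz_inv.coeFn_compLp h.inv_zero f,
    h.lipschitz_inv.coeFn_compLp h.inv_zero f', hc0] with x h1 h2 h3 h4 h5 h6
  rw [h1, h2, h3, Pi.sub_apply, Pi.sub_apply, h4, h5, smul_eq_mul, mul_assoc]
  refine mul_nonneg h6 ?_
  have := h.mul_sub_nonneg (B (f x)) (B (f' x))
  rwa [h.apply_inv, h.apply_inv] at this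

lemma IsKirchhoffPair.norm_bddSMul_sub_le (h : IsKirchhoffPair a A B K)
    (hc : AEStronglyMeasurable c (volume.restrict Ω))
    (hcK : ∀ᵐ x ∂(volume.restrict Ω), |c x| ≤ K) (f f' : L2 Ω) :
    ‖bddSMul hc hcK (h.lipschitz_inv.compLp h.inv_zero f) -
      bddSMul hc hcK (h.lipschitz_inv.compLp h.inv_zero f')‖ ≤ (K * K : ℝ) * ‖f - f'‖ := by
  have h1 := h.lipschitz_inv.norm_compLp_sub_le h.inv_zero f f'
  have h2 := norm_bddSMul_le hc hcK (h.lipschitz_inv.compLp h.inv_zero f -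
    h.lipschitz_inv.compLp h.inv_zero f')
  rw [bddSMul_sub, mul_assoc]
  exact h2.trans (mul_le_mul_of_nonneg_left h1 K.2)

lemma HasPoincare.coercive {C : ℝ} (hP : HasPoincare Ω C) {d : H1 Ω} (hd : d ∈ zeroTrace Ω) :
    1 / (C ^ 2 + 1) * ‖d‖ ^ 2 ≤ ‖gradL d‖ ^ 2 := by
  have h1 := d.norm_sq
  have h3 := pow_le_pow_left₀ (norm_nonneg _) (hP d hd) 2
  rw [mul_pow] at h3
  rw [h1, gradL_apply, one_div_mul_eq_div, div_le_iff₀ (by positivity)]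
  linarith

/-- The weak form of `-ΔU + c B(U) = 0` is solvable for `U ∈ U₀ + zeroTrace Ω`. -/
lemma exists_transformed_solution {C : ℝ} (hP : HasPoincare Ω C)
    (h : IsKirchhoffPair a A B K) (hc : AEStronglyMeasurable c (volume.restrict Ω))
    (hc0 : ∀ᵐ x ∂(volume.restrict Ω), 0 ≤ c x) (hcK : ∀ᵐ x ∂(volume.restrict Ω), |c x| ≤ K)
    (U₀ : H1 Ω) : ∃ w : H1 Ω, HasTrace w 0 ∧ ∀ v : H1 Ω, HasTrace v 0 →
      inner ℝ (U₀ + w).grad v.grad + inner ℝ (bddSMul hc hcK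
        (h.lipschitz_inv.compLp h.inv_zero (U₀ + w).fn)) v.fn = 0 := by
  have hm : 0 < 1 / (C ^ 2 + 1) := by positivity
  exact exists_variational_solution_mem (zeroTrace Ω) isClosed_zeroTrace gradL fnL
    (mul_nonneg K.2 K.2) hm (fun _ hd => hP.coercive hd)
    (h.norm_bddSMul_sub_le hc hcK) (h.inner_bddSMul_sub_nonneg hc hc0 hcK) U₀.grad U₀.fn

/-- Solve the transformed problem for `U` with trace `A(g)` and set `u = B(U)`. The chain rule for
`B` gives `a(u)∇u = ∇U` and the trace `B(A(g)) = g`. -/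
lemma exists_isWeakSolution {C : ℝ} (hP : HasPoincare Ω C)
    (h : IsKirchhoffPair a A B K) (hc : AEStronglyMeasurable c (volume.restrict Ω))
    (hc0 : ∀ᵐ x ∂(volume.restrict Ω), 0 ≤ c x) (hcK : ∀ᵐ x ∂(volume.restrict Ω), |c x| ≤ K)
    (g : HHalf Ω) : ∃ u, IsWeakSolution a c g u := by
  obtain ⟨u₀, hu₀⟩ := g.exists_extension
  obtain ⟨U₀, -, -, hU₀⟩ := h.exists_transform hu₀
  obtain ⟨w, hw, heq⟩ := exists_transformed_solution hP h hc hc0 hcK U₀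
  have hU := hU₀.add hw
  rw [add_zero] at hU
  obtain ⟨u, hu1, hu2, hu3⟩ := chain h.cont_inv h.hasDerivAt_inv h.bound_inv h.inv_zero hU
  have hBA : h.lipschitz_inv.compLp h.inv_zero (h.lipschitz.compLp h.map_zero g.toL2) = g.toL2 := by
    refine Lp.ext ?_
    filter_upwards [h.lipschitz_inv.coeFn_compLp h.inv_zero
      (h.lipschitz.compLp h.map_zero g.toL2), h.lipschitz.coeFn_compLp h.map_zero g.toL2] with x h1 h2
    rw [h1, Function.comp_apply, h2, Function.comp_apply, h.inv_apply]
  refine ⟨u, ?_, fun v hv => ?_⟩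
  · rwa [hBA] at hu3
  · have hgr : (U₀ + w).grad =ᵐ[volume.restrict Ω] fun x => a (u.fn x) • u.grad x := by
      have h1 : u.fn =ᵐ[volume.restrict Ω] B ∘ (U₀ + w).fn := by
        rw [hu1]
        exact h.lipschitz_inv.coeFn_compLp h.inv_zero _
      have h2 : u.grad =ᵐ[volume.restrict Ω]
          fun x => (a (B ((U₀ + w).fn x)))⁻¹ • (U₀ + w).grad x := by
        rw [hu2]
        exact coeFn_compSMul _ _ _ _
      filter_upwards [h1, h2] with x h1 h2
      rw [h1, h2, Function.comp_apply, smul_inv_smul₀ (h.pos _).ne']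
    rw [form_eq_inner hgr hc hcK, hu1]
    exact heq v hv

/-! ### The co-normal derivative -/

/-- The infimum in the `H^{1/2}` norm need not be shown to be attained: an extension within `ε / (C
+ 1)` of it suffices, where the `+ 1` covers `C = 0`. -/
lemma HMinusHalf.norm_le_of_forall {ψ : HMinusHalf Ω} {C : ℝ} (hC : 0 ≤ C)
    (h : ∀ (v : H1 Ω) (g : HHalf Ω), HasTrace v g.toL2 → |ψ g| ≤ C * ‖v‖) : ‖ψ‖ ≤ C := by
  refine ψ.opNorm_le_bound hC fun g => ?_
  refine le_of_forall_pos_le_add fun ε hε => ?_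
  obtain ⟨v, hv, hlt⟩ := g.exists_lt (ε := ε / (C + 1)) (by positivity)
  have h1 := h v g hv
  have h2 : C * ‖v‖ ≤ C * (‖g‖ + ε / (C + 1)) := mul_le_mul_of_nonneg_left hlt.le hC
  have h3 : C * (ε / (C + 1)) ≤ ε := by
    rw [mul_div_assoc', div_le_iff₀ (by positivity)]
    nlinarith
  rw [Real.norm_eq_abs]
  linarith

/-- A functional on `H¹(Ω)` vanishing on functions with zero trace descends to `H^{1/2}(∂Ω)`. -/
lemma exists_descent (ℓ : H1 Ω →L[ℝ] ℝ) (h0 : ∀ v, HasTrace v 0 → ℓ v = 0) :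
    ∃ ψ : HMinusHalf Ω, ∀ (v : H1 Ω) (g : HHalf Ω), HasTrace v g.toL2 → ψ g = ℓ v := by
  -- The chosen extensions need not depend linearly on `g`; linearity holds after applying `ℓ`,
  -- since two extensions of one datum differ by a function of zero trace.
  choose e he using fun g : HHalf Ω => g.exists_extension
  have key : ∀ (v : H1 Ω) (g : HHalf Ω), HasTrace v g.toL2 → ℓ (e g) = ℓ v := by
    intro v g hv
    have h1 := h0 _ (by simpa using (he g).sub hv)
    rwa [map_sub, sub_eq_zero] at h1
  let L : HHalf Ω →ₗ[ℝ] ℝ :=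
    { toFun := fun g => ℓ (e g)
      map_add' := fun g g' => by
        rw [← map_add]
        exact key _ _ (by rw [map_add]; exact (he g).add (he g'))
      map_smul' := fun r g => by
        rw [RingHom.id_apply, ← map_smul]
        exact key _ _ (by rw [map_smul]; exact (he g).smul r) }
  refine ⟨L.mkContinuous ‖ℓ‖ fun g => ?_, fun v g hv => key v g hv⟩
  refine le_of_forall_pos_le_add fun ε hε => ?_
  obtain ⟨v, hv, hlt⟩ := g.exists_lt (ε := ε / (‖ℓ‖ + 1)) (by positivity)
  have h1 : ‖L g‖ ≤ ‖ℓ‖ * ‖v‖ := by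
    change ‖ℓ (e g)‖ ≤ _
    rw [key v g hv]
    exact ℓ.le_opNorm v
  have h2 : ‖ℓ‖ * ‖v‖ ≤ ‖ℓ‖ * (‖g‖ + ε / (‖ℓ‖ + 1)) :=
    mul_le_mul_of_nonneg_left hlt.le (norm_nonneg ℓ)
  have h3 : ‖ℓ‖ * (ε / (‖ℓ‖ + 1)) ≤ ε := by
    rw [mul_div_assoc', div_le_iff₀ (by positivity)]
    nlinarith [norm_nonneg ℓ]
  linarith

/-- For fixed `u` the form is a bounded linear functional of `v`, and the weak equation says that it
vanishes on zero traces, so it descends to the boundary. -/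
lemma IsWeakSolution.exists_isConormalDerivative (h : IsKirchhoffPair a A B K)
    (hc : AEStronglyMeasurable c (volume.restrict Ω))
    (hcK : ∀ᵐ x ∂(volume.restrict Ω), |c x| ≤ K) {g : HHalf Ω} {u : H1 Ω}
    (hu : IsWeakSolution a c g u) : ∃ ψ, IsConormalDerivative a c u ψ := by
  have hp := coeFn_compSMul h.cont h.bound u.fn u.grad
  have e : ∀ v, form a c u v = ((innerSL ℝ (compSMul h.cont h.bound u.fn u.grad)).comp gradL +
      (innerSL ℝ (bddSMul hc hcK u.fn)).comp fnL) v := fun v => form_eq_inner hp hc hcK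
  obtain ⟨ψ, hψ⟩ := exists_descent _ fun v hv => (e v).symm.trans (hu.2 v hv)
  exact ⟨ψ, fun v k hv => (hψ v k hv).trans (e v).symm⟩

lemma Admissible.existsUnique (h : Admissible Ω a c) (hn : n ≠ 0) (hΩ : IsPiecewiseC1Domain Ω)
    (g : HHalf Ω) : ∃! u, IsWeakSolution a c g u := by
  obtain ⟨C, -, hP⟩ := hΩ.exists_hasPoincare hn
  obtain ⟨A, B, K, hK, hc0, hcK⟩ := h.exists_isKirchhoffPair
  obtain ⟨u, hu⟩ := exists_isWeakSolution hP hK h.2.1 hc0 hcK g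
  exact ⟨u, hu, fun v hv => hv.unique hP hK h.2.1 hc0 hcK hu⟩

/-- The choice operator returns the co-normal derivative of some weak solution; uniqueness
identifies that solution with `u`. -/
lemma Admissible.isConormalDerivative_DtN (h : Admissible Ω a c) (hn : n ≠ 0)
    (hΩ : IsPiecewiseC1Domain Ω) {g : HHalf Ω} {u : H1 Ω} (hu : IsWeakSolution a c g u) :
    IsConormalDerivative a c u (DtN Ω a c g) := by
  obtain ⟨A, B, K, hK, hc0, hcK⟩ := h.exists_isKirchhoffPair
  obtain ⟨ψ, hψ⟩ := hu.exists_isConormalDerivative hK h.2.1 hcK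
  obtain ⟨v, hv, hv'⟩ := Classical.epsilon_spec (p := fun ψ => ∃ u : H1 Ω,
    IsWeakSolution a c g u ∧ IsConormalDerivative a c u ψ) ⟨ψ, u, hu, hψ⟩
  rw [(h.existsUnique hn hΩ g).unique hu hv]
  exact hv'

end

section

/-! ### Linearization at zero -/

variable {n : ℕ} {Ω : Set (E n)} {a A B : ℝ → ℝ} {c : E n → ℝ} {K : NNReal}

/-- The `L²` error `a(τz)∇z - a(0)∇z` of freezing the coefficient at zero. -/
noncomputable def freezingError (ha : Continuous a) (haK : ∀ t, |a t| ≤ K) (z : H1 Ω) (τ : ℝ) :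
    L2vec Ω := compSMul ha haK (τ • z.fn) z.grad - compSMul ha haK (0 : L2 Ω) z.grad

/-- At almost every `x`, `τz(x) → 0` and hence `a(τz(x)) → a(0)`; boundedness of `a` provides a
multiple of `|∇z|` as majorant. -/
lemma tendsto_freezingError (ha : Continuous a) (haK : ∀ t, |a t| ≤ K) (z : H1 Ω) :
    Tendsto (freezingError ha haK z) (𝓝 0) (𝓝 0) := by
  have h := tendsto_compSMul_left ha haK (l := 𝓝 (0 : ℝ)) (u := fun τ : ℝ => τ • z.fn) (v := 0)
    z.grad (φ := fun τ x => τ * z.fn x) (fun τ => Lp.coeFn_smul τ z.fn) (by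
      filter_upwards [Lp.coeFn_zero ℝ 2 (volume.restrict Ω)] with x hx
      rw [hx, Pi.zero_apply]
      have : Tendsto (fun τ : ℝ => τ * z.fn x) (𝓝 0) (𝓝 (0 * z.fn x)) :=
        tendsto_id.mul_const _
      rwa [zero_mul] at this)
  have h' := h.sub_const (compSMul ha haK (0 : L2 Ω) z.grad)
  rw [sub_self] at h'
  exact h'

/-- With `V = A(u)` and `P = A(τz)`, where `u` and `z` solve the quasilinear and the linear problem
with data `τg` and `g`, the difference quotient `D = (V - P)/τ` has vanishing trace and is
controlled by the freezing error, and it controls the fluxes and the solutions. -/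
lemma exists_quotient {C : ℝ} (hC : 0 ≤ C) (hP : HasPoincare Ω C) (h : IsKirchhoffPair a A B K)
    (hc : AEStronglyMeasurable c (volume.restrict Ω))
    (hc0 : ∀ᵐ x ∂(volume.restrict Ω), 0 ≤ c x) (hcK : ∀ᵐ x ∂(volume.restrict Ω), |c x| ≤ K)
    {g : HHalf Ω} {τ : ℝ} (hτ : τ ≠ 0) {u z : H1 Ω} (hu : IsWeakSolution a c (τ • g) u)
    (hz : IsWeakSolution (fun _ => a 0) c g z) (v : H1 Ω) :
    |τ⁻¹ * form a c u v - form (fun _ => a 0) c z v| ≤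
      (2 + K * (K * C)) * ‖freezingError h.cont h.bound z τ‖ * ‖v‖ := by
  have hzτ : HasTrace (τ • z) (τ • g).toL2 := by
    rw [map_smul]
    exact hz.1.smul τ
  obtain ⟨V, V1, V2, V3⟩ := h.exists_transform hu.1
  obtain ⟨P, P1, P2, P3⟩ := h.exists_transform hzτ
  set r := freezingError h.cont h.bound z τ with hr
  set D : H1 Ω := τ⁻¹ • (V - P) with hD
  have hDtr : HasTrace D 0 := by simpa using (V3.sub P3).smul τ⁻¹
  have hDg : D.grad = τ⁻¹ • (V.grad - P.grad) := rfl
  have hDf : D.fn = τ⁻¹ • (V.fn - P.fn) := rfl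
  have hzf : (τ • z).fn = τ • z.fn := rfl
  have hzg : (τ • z).grad = τ • z.grad := rfl
  have hPg : P.grad = τ • compSMul h.cont h.bound (τ • z.fn) z.grad := by
    refine Lp.ext ?_
    filter_upwards [P2, Lp.coeFn_smul τ (compSMul h.cont h.bound (τ • z.fn) z.grad),
      coeFn_compSMul h.cont h.bound (τ • z.fn) z.grad, Lp.coeFn_smul τ z.grad] with x h1 h2 h3 h4
    rw [h1, h2, Pi.smul_apply, h3, hzf, hzg, h4, Pi.smul_apply, smul_comm]
  set Q := compSMul h.cont h.bound (0 : L2 Ω) z.grad with hQ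
  have hQ' : Q =ᵐ[volume.restrict Ω] fun x => (fun _ : ℝ => a 0) (z.fn x) • z.grad x := by
    filter_upwards [coeFn_compSMul h.cont h.bound (0 : L2 Ω) z.grad,
      Lp.coeFn_zero ℝ 2 (volume.restrict Ω)] with x h1 h2
    rw [h1, h2, Pi.zero_apply]
  set w := τ⁻¹ • u.fn - z.fn with hw
  have hflux : τ⁻¹ • V.grad - Q = D.grad + r := by
    rw [hDg, smul_sub, hPg, inv_smul_smul₀ hτ, hr, freezingError]
    abel
  have hcw : bddSMul hc hcK w = τ⁻¹ • bddSMul hc hcK u.fn - bddSMul hc hcK z.fn := by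
    rw [hw, ← bddSMul_sub]
    congr 1
    refine Lp.ext ?_
    filter_upwards [coeFn_bddSMul hc hcK (τ⁻¹ • u.fn), coeFn_bddSMul hc hcK u.fn,
      Lp.coeFn_smul τ⁻¹ u.fn, Lp.coeFn_smul τ⁻¹ (bddSMul hc hcK u.fn)] with x h1 h2 h3 h4
    rw [h1, h3, h4, Pi.smul_apply, Pi.smul_apply, h2, smul_comm]
  have hform : ∀ v : H1 Ω, τ⁻¹ * form a c u v - form (fun _ => a 0) c z v =
      inner ℝ (D.grad + r) v.grad + inner ℝ (bddSMul hc hcK w) v.fn := by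
    intro v
    rw [form_eq_inner V2 hc hcK, form_eq_inner hQ' hc hcK, ← hflux, hcw, inner_sub_left,
      inner_sub_left, real_inner_smul_left, real_inner_smul_left]
    ring
  have hae : ∀ᵐ x ∂(volume.restrict Ω),
      w x = τ⁻¹ * (u.fn x - τ * z.fn x) ∧ D.fn x = τ⁻¹ * (A (u.fn x) - A (τ * z.fn x)) := by
    filter_upwards [Lp.coeFn_sub (τ⁻¹ • u.fn) z.fn, Lp.coeFn_smul τ⁻¹ u.fn,
      Lp.coeFn_smul τ⁻¹ (V.fn - P.fn), Lp.coeFn_sub V.fn P.fn, V1, P1,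
      Lp.coeFn_smul τ z.fn] with x h1 h2 h3 h4 h5 h6 h7
    constructor
    · rw [h1, Pi.sub_apply, h2, Pi.smul_apply, smul_eq_mul]
      field_simp
    · rw [hDf, h3, Pi.smul_apply, h4, Pi.sub_apply, h5, h6, hzf, h7, Pi.smul_apply, smul_eq_mul,
        smul_eq_mul]
  -- The Lipschitz bound for `B`, read backwards: `|s - t| ≤ K |A s - A t|`.
  have hwD : ‖w‖ ≤ K * ‖D.fn‖ := by
    refine Lp.norm_le_mul_norm_of_ae_le_mul ?_
    filter_upwards [hae] with x hx
    rw [hx.1, hx.2, Real.norm_eq_abs, Real.norm_eq_abs, abs_mul, abs_mul, mul_left_comm]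
    exact mul_le_mul_of_nonneg_left (h.abs_sub_le _ _) (abs_nonneg _)
  have hpos : 0 ≤ (inner ℝ (bddSMul hc hcK w) D.fn : ℝ) := by
    refine inner_nonneg_of_ae ?_
    filter_upwards [hae, coeFn_bddSMul hc hcK w, hc0] with x hx h1 h2
    rw [h1, hx.1, hx.2, smul_eq_mul, mul_assoc]
    refine mul_nonneg h2 ?_
    rw [mul_mul_mul_comm]
    exact mul_nonneg (mul_self_nonneg _) (h.mul_sub_nonneg _ _)
  have htest := hform D
  rw [hu.2 D hDtr, hz.2 D hDtr, mul_zero, sub_zero, inner_add_left,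
    real_inner_self_eq_norm_sq] at htest
  have hDr : ‖D.grad‖ ≤ ‖r‖ := by
    have h1 := abs_le.1 (abs_real_inner_le_norm r D.grad)
    by_contra! hlt
    nlinarith [norm_nonneg r, norm_nonneg D.grad]
  have hDfr : ‖D.fn‖ ≤ C * ‖r‖ := (hP D hDtr).trans (mul_le_mul_of_nonneg_left hDr hC)
  -- The factors are the bound of `c`, the Lipschitz constant of `B` and the Poincaré constant, in
  -- this order.
  have hcw' : ‖bddSMul hc hcK w‖ ≤ K * (K * (C * ‖r‖)) :=
    (norm_bddSMul_le hc hcK w).trans (mul_le_mul_of_nonneg_left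
      (hwD.trans (mul_le_mul_of_nonneg_left hDfr K.2)) K.2)
  have hfl : ‖D.grad + r‖ ≤ 2 * ‖r‖ := (norm_add_le _ _).trans (by linarith)
  rw [hform]
  have b1 : |inner ℝ (D.grad + r) v.grad| ≤ 2 * ‖r‖ * ‖v‖ :=
    (abs_real_inner_le_norm _ _).trans
      (mul_le_mul hfl v.norm_grad_le (norm_nonneg _) (by positivity))
  have b2 : |inner ℝ (bddSMul hc hcK w) v.fn| ≤ K * (K * (C * ‖r‖)) * ‖v‖ :=
    (abs_real_inner_le_norm _ _).trans
      (mul_le_mul hcw' v.norm_fn_le (norm_nonneg _) (by positivity))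
  refine (abs_add_le _ _).trans ((add_le_add b1 b2).trans_eq ?_)
  ring

/-- The bound of `exists_quotient` is a null quantity times `‖v‖` for every extension `v` of the
boundary test datum, so it controls the dual norm. -/
lemma Admissible.tendsto_DtN (h : Admissible Ω a c) (hn : n ≠ 0) (hΩ : IsPiecewiseC1Domain Ω)
    (g : HHalf Ω) : Tendsto (fun τ : ℝ => (1 / τ) • DtN Ω a c (τ • g)) (𝓝[≠] 0)
      (𝓝 (linearDtN Ω (a 0) c g)) := by
  obtain ⟨C, hC, hP⟩ := hΩ.exists_hasPoincare hn
  obtain ⟨A, B, K, hK, hc0, hcK⟩ := h.exists_isKirchhoffPair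
  obtain ⟨z, hz, -⟩ := (h.const 0).existsUnique hn hΩ g
  have hzc := (h.const 0).isConormalDerivative_DtN hn hΩ hz
  rw [tendsto_iff_norm_sub_tendsto_zero]
  have hlim : Tendsto (fun τ => (2 + K * (K * C)) * ‖freezingError hK.cont hK.bound z τ‖)
      (𝓝[≠] 0) (𝓝 0) := by
    have h1 := ((tendsto_freezingError hK.cont hK.bound z).mono_left
      (nhdsWithin_le_nhds (s := {(0 : ℝ)}ᶜ))).norm.const_mul (2 + K * (K * C))
    simpa using h1
  refine tendsto_of_tendsto_of_tendsto_of_le_of_le' tendsto_const_nhds hlim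
    (Eventually.of_forall fun _ => norm_nonneg _) ?_
  filter_upwards [self_mem_nhdsWithin] with τ hτ
  obtain ⟨u, hu, -⟩ := h.existsUnique hn hΩ (τ • g)
  have huc := h.isConormalDerivative_DtN hn hΩ hu
  refine HMinusHalf.norm_le_of_forall (mul_nonneg (by positivity) (norm_nonneg _)) fun v k hv => ?_
  have e : ((1 / τ) • DtN Ω a c (τ • g) - linearDtN Ω (a 0) c g) k =
      τ⁻¹ * form a c u v - form (fun _ => a 0) c z v := by
    rw [← huc v k hv, ← hzc v k hv, one_div]
    rfl
  rw [e]
  exact exists_quotient hC hP hK h.2.1 hc0 hcK hτ hu hz v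

end

end QuasilinearDtN

theorem lemma1 (n : ℕ) (hn : n = 2 ∨ n = 3) (Ω : Set (EuclideanSpace ℝ (Fin n)))
    (hΩ : QuasilinearDtN.IsPiecewiseC1Domain Ω) :
    -- both boundary value problems are uniquely solvable and both maps are well defined
    (∀ (a : ℝ → ℝ) (c : EuclideanSpace ℝ (Fin n) → ℝ), QuasilinearDtN.Admissible Ω a c →
      (∀ g : QuasilinearDtN.HHalf Ω,
        (∃! u, QuasilinearDtN.IsWeakSolution a c g u) ∧
        (∀ u, QuasilinearDtN.IsWeakSolution a c g u →
          QuasilinearDtN.IsConormalDerivative a c u (QuasilinearDtN.DtN Ω a c g)) ∧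
        (∃! v, QuasilinearDtN.IsWeakSolution (fun _ => a 0) c g v) ∧
        (∀ v, QuasilinearDtN.IsWeakSolution (fun _ => a 0) c g v →
          QuasilinearDtN.IsConormalDerivative (fun _ => a 0) c v
            (QuasilinearDtN.linearDtN Ω (a 0) c g)))) ∧
    -- the limit formula
    (∀ (a : ℝ → ℝ) (c : EuclideanSpace ℝ (Fin n) → ℝ), QuasilinearDtN.Admissible Ω a c →
      ∀ g : QuasilinearDtN.HHalf Ω,
        Tendsto (fun τ : ℝ => (1 / τ) • QuasilinearDtN.DtN Ω a c (τ • g)) (𝓝[≠] 0)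
          (𝓝 (QuasilinearDtN.linearDtN Ω (a 0) c g))) ∧
    -- the nonlinear map determines the linearized one
    (∀ (a₁ a₂ : ℝ → ℝ) (c₁ c₂ : EuclideanSpace ℝ (Fin n) → ℝ),
      QuasilinearDtN.Admissible Ω a₁ c₁ → QuasilinearDtN.Admissible Ω a₂ c₂ →
      QuasilinearDtN.DtN Ω a₁ c₁ = QuasilinearDtN.DtN Ω a₂ c₂ →
      QuasilinearDtN.linearDtN Ω (a₁ 0) c₁ = QuasilinearDtN.linearDtN Ω (a₂ 0) c₂) := by
  have hn0 : n ≠ 0 := by omega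
  refine ⟨fun a c h g => ⟨h.existsUnique hn0 hΩ g,
    fun u hu => h.isConormalDerivative_DtN hn0 hΩ hu, (h.const 0).existsUnique hn0 hΩ g,
    fun v hv => (h.const 0).isConormalDerivative_DtN hn0 hΩ hv⟩,
    fun a c h g => h.tendsto_DtN hn0 hΩ g, fun a₁ a₂ c₁ c₂ h₁ h₂ heq => funext fun g => ?_⟩
  have t := h₁.tendsto_DtN hn0 hΩ g
  rw [heq] at t
  exact tendsto_nhds_unique t (h₂.tendsto_DtN hn0 hΩ g)
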